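/- Let $V:\mathbb R\to\mathbb R$ be a non-negative $C^2$ function which is class $2$ well behaved at infinity, of exponential order $N$ with $N^2<6$. That is: $V(\varphi)>0$ for all large $\varphi$; $W_V(\varphi)=V'(\varphi)/V(\varphi)-N\to0$ as $\varphi\to\infty$; and for some $\varphi_0>0$ with $V>0$ on $[\varphi_0,\infty)$ there is a strictly decreasing $C^3$ function $f$ mapping $[\varphi_0,\infty)$ onto $(0,f(\varphi_0)]$, with $f(\varphi)\to0$ as $\varphi\to\infty$, such that, as functions of $z=f(\varphi)$ (with the value at $z=0$ being the limit as $\varphi\to\infty$), $W_V$ and $f'$ become $C^2$ functions $\overline W_V(z)$ and $\overline{f'}(z)$ on $[0,f(\varphi_0)]$ with $\frac{d\overline W_V}{dz}(0)=\frac{d\overline{f'}}{dz}(0)=0$. Fix any such $\varphi_0$ and $f$, and any $\epsilon>0$ with $\epsilon^{-1}\ge\varphi_0$. Consider the expanding spatially flat FRW scalar field cosmologies, i.e. the solutions $(K,\varphi,\dot\varphi)(t)$ with $K>0$ of $$\frac{d\varphi}{dt}=\dot\varphi,\qquad \frac{d\dot\varphi}{dt}=-K\dot\varphi-V'(\varphi),\qquad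 \frac{dK}{dt}=-\tfrac32\dot\varphi^2,\qquad K^2=3V(\varphi)+\tfrac32\dot\varphi^2 .$$ In terms of $y=\sqrt{3/2}\,\dot\varphi/K$, $z=f(\varphi)$ and a time $\tau$ with $d\tau/dt=K$, they satisfy, where $\varphi>\epsilon^{-1}$, the system $$\frac{dy}{d\tau}=-\Bigl(y+\tfrac1{\sqrt6}\bigl(\overline W_V(z)+N\bigr)\Bigr)(1-y^2),\qquad \frac{dz}{d\tau}=\sqrt{\tfrac23}\,\overline{f'}(z)\,y,$$ which extends to the closed rectangle $\tilde\Omega_\epsilon=[-1,1]\times[0,f(\epsilon^{-1})]$ of points $(y,z)$. Let $p_-=(-1,0)$, an equilibrium point of this system. Then there is a neighbourhood $\mathcal N(p_-)$ of $p_-$ in $\tilde\Omega_\epsilon$ such that for every $p\in\mathcal N(p_-)$ the past trajectory $\psi_p(\tau)$ of $p$ in $\tilde\Omega_\epsilon$ exists for all $\tau\le0$, is unique, and tends to $p_-$ as $\tau\to-\infty$. If moreover $p$ represents a physical state $(K_1,\varphi_1,\dot\varphi_1)$ with $\varphi_1>\epsilon^{-1}$, then, after a translation of $t$, the unique solution $(K,\varphi,\dot\varphi)(t)$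 of the field equations through this state, continued maximally into the past, is defined exactly on $0<t\le T$, where $T>0$ is the time at which it takes the value $(K_1,\varphi_1,\dot\varphi_1)$; on $(0,T]$ it satisfies $\varphi>\epsilon^{-1}$ and it is the trajectory $\psi_p$, parametrised by $\tau$ with $d\tau/dt=K$, $\tau(T)=0$ and $\tau\to-\infty$ as $t\to0^+$; and there is a constant $c>0$, depending on the trajectory, such that, as $t\to0^+$, $$K=t^{-1}+O(\varepsilon_V(t)),\qquad \varphi=-\sqrt{\tfrac23}\,\ln\frac tc+O(t\,\varepsilon_V(t)),\qquad \dot\varphi=-\sqrt{\tfrac23}\,t^{-1}+O(\varepsilon_V(t)),$$ where $\varepsilon_V(t)=t\,V\bigl(-\sqrt{2/3}\,\ln t\bigr)$. -/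

import Mathlib

open Set Filter Topology Asymptotics

noncomputable section

namespace FRW

/-- The function `W_V = V'/V - N`. -/
def WV (V : ℝ → ℝ) (N : ℝ) (φ : ℝ) : ℝ := deriv V φ / V φ - N

/-- `V` is a `C²` non-negative potential that is well behaved at infinity (WBI), of exponential
order `N`. -/
structure IsWBI (V : ℝ → ℝ) (N : ℝ) : Prop where
  contDiff : ContDiff ℝ 2 V
  nonneg : ∀ φ, 0 ≤ V φ
  eventually_pos : ∃ φ₀ > 0, ∀ φ > φ₀, 0 < V φ
  tendsto_WV : Tendsto (WV V N) atTop (𝓝 0)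

/-- The function `ḡ` of `z = f φ` that a function `g` of `φ ∈ [φ₀, ∞)` becomes:
`g (f⁻¹ z)` for `z > 0`, and the limit of `g` at infinity for `z = 0`. -/
def bar (f : ℝ → ℝ) (φ₀ : ℝ) (g : ℝ → ℝ) (z : ℝ) : ℝ :=
  if 0 < z then g (Function.invFunOn f (Ici φ₀) z) else limUnder atTop g

/-- `f̄'` as a function of `z`, where `f'` is the derivative of `f` on `[φ₀, ∞)`. -/
def fbar (f : ℝ → ℝ) (φ₀ : ℝ) : ℝ → ℝ := bar f φ₀ (derivWithin f (Ici φ₀))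

/-- `W̄_V` as a function of `z`. -/
def Wbar (V : ℝ → ℝ) (N : ℝ) (f : ℝ → ℝ) (φ₀ : ℝ) : ℝ → ℝ := bar f φ₀ (WV V N)

/-- `z = f φ`, on `[φ₀, ∞)`, is a coordinate of class `k` at infinity for the potential `V` of
exponential order `N`. -/
structure IsCoordinate (k : ℕ) (V : ℝ → ℝ) (N : ℝ) (f : ℝ → ℝ) (φ₀ : ℝ) : Prop where
  pos : 0 < φ₀
  V_pos : ∀ φ, φ₀ ≤ φ → 0 < V φ
  image_eq : f '' Ici φ₀ = Ioc 0 (f φ₀)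
  tendsto_zero : Tendsto f atTop (𝓝 0)
  contDiffOn : ContDiffOn ℝ (k + 1) f (Ici φ₀)
  strictAntiOn : StrictAntiOn f (Ici φ₀)
  contDiffOn_Wbar : ContDiffOn ℝ k (Wbar V N f φ₀) (Icc 0 (f φ₀))
  contDiffOn_fbar : ContDiffOn ℝ k (fbar f φ₀) (Icc 0 (f φ₀))
  deriv_Wbar : HasDerivWithinAt (Wbar V N f φ₀) 0 (Icc 0 (f φ₀)) 0
  deriv_fbar : HasDerivWithinAt (fbar f φ₀) 0 (Icc 0 (f φ₀)) 0

/-- `V` is a class `k` WBI potential, of exponential order `N`. -/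
structure IsClassWBI (k : ℕ) (V : ℝ → ℝ) (N : ℝ) : Prop where
  isWBI : IsWBI V N
  contDiff : ContDiff ℝ k V
  exists_coordinate : ∃ f φ₀, IsCoordinate k V N f φ₀

/-- The physical phase space of expanding solutions: triples `(K, φ, φ̇)` with `K > 0` that satisfy
the constraint. -/
def physicalSpace (V : ℝ → ℝ) : Set (ℝ × ℝ × ℝ) :=
  {q | 0 < q.1 ∧ q.1 ^ 2 = 3 * V q.2.1 + 3 / 2 * q.2.2 ^ 2}

/-- The part `φ > 1/ε` of the physical phase space. -/
def physicalNear (V : ℝ → ℝ) (ε : ℝ) : Set (ℝ × ℝ × ℝ) :=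
  {q | q ∈ physicalSpace V ∧ ε⁻¹ < q.2.1}

/-- `(K, φ, φ̇)` is a solution of the field equations, with constraint, on the time set `I`. -/
structure IsSolution (V : ℝ → ℝ) (I : Set ℝ) (K φ φdot : ℝ → ℝ) : Prop where
  mem : ∀ t ∈ I, (K t, φ t, φdot t) ∈ physicalSpace V
  deriv_φ : ∀ t ∈ I, HasDerivWithinAt φ (φdot t) I t
  deriv_φdot : ∀ t ∈ I, HasDerivWithinAt φdot (-K t * φdot t - deriv V (φ t)) I t
  deriv_K : ∀ t ∈ I, HasDerivWithinAt K (-(3 / 2) * φdot t ^ 2) I t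

/-- The coordinates `y = √(3/2) φ̇ / K` and `z = f φ` of a physical state `(K, φ, φ̇)`. -/
def toYZ (f : ℝ → ℝ) (q : ℝ × ℝ × ℝ) : ℝ × ℝ := (√(3 / 2) * q.2.2 / q.1, f q.2.1)

/-- The closed rectangle `-1 ≤ y ≤ 1`, `0 ≤ z ≤ f (1/ε)`, which is the closure of the set of
`(y, z)`-coordinates of the physical states with `φ > 1/ε`. -/
def closedRegion (f : ℝ → ℝ) (ε : ℝ) : Set (ℝ × ℝ) := Icc (-1) 1 ×ˢ Icc 0 (f ε⁻¹)

/-- The vector field of the dynamical system in the variables `(y, z)`. -/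
def field (V : ℝ → ℝ) (N : ℝ) (f : ℝ → ℝ) (φ₀ : ℝ) (p : ℝ × ℝ) : ℝ × ℝ :=
  (-(p.1 + 1 / √6 * (Wbar V N f φ₀ p.2 + N)) * (1 - p.1 ^ 2), √(2 / 3) * fbar f φ₀ p.2 * p.1)

/-- `γ` is a trajectory, on the set `I` of times `τ`, of the `(y, z)`-system on the closed
rectangle. -/
structure IsTrajectory (V : ℝ → ℝ) (N : ℝ) (f : ℝ → ℝ) (φ₀ ε : ℝ) (I : Set ℝ)
    (γ : ℝ → ℝ × ℝ) : Prop where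
  mem : ∀ τ ∈ I, γ τ ∈ closedRegion f ε
  deriv : ∀ τ ∈ I, HasDerivWithinAt γ (field V N f φ₀ (γ τ)) I τ

/-- The equilibrium point `p₋ = (-1, 0)`. -/
def pMinus : ℝ × ℝ := (-1, 0)

/-- The error function `ε_V(t) = t V(-√(2/3) ln t)`. -/
def epsV (V : ℝ → ℝ) (t : ℝ) : ℝ := t * V (-√(2 / 3) * Real.log t)

/-- `(K, φ, φ̇)`, defined for small `t > 0`, is asymptotic, as `t → 0⁺`, to the massless scalar
field solution with constant `c`, up to the errors given by `ε_V`. -/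
structure HasMasslessAsymptotics (V K φ φdot : ℝ → ℝ) (c : ℝ) : Prop where
  K_asymp : (fun t => K t - t⁻¹) =O[𝓝[>] 0] epsV V
  φ_asymp : (fun t => φ t - -√(2 / 3) * Real.log (t / c)) =O[𝓝[>] 0] fun t => t * epsV V t
  φdot_asymp : (fun t => φdot t - -√(2 / 3) * t⁻¹) =O[𝓝[>] 0] epsV V

end FRW

end

/-! At `p₋` the factor of `1 - y²` in `dy/dτ` equals `1 - N/√6 > 0`, so on a small box around `p₋`
it is at least some `κ > 0`. There `y` and `z` both decrease into the past while the lines `y = -1`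
and `z = 0` are invariant, so a backward orbit never leaves the box, and `1 + y = O(exp (κ τ))`. The
linearisation says nothing in the `z` direction. Instead, `φ' = √(2/3) y` with `1 + y` integrable
gives `φ = -√(2/3) τ + O(1)`, hence `φ → ∞` and `z = f φ → 0`.

The same integrability (`bounds_of_deriv_le`) governs the Hubble parameter: `(log H)' = -y²` yields
`H` comparable to `exp (-τ)`. So `t = ∫ dτ/H` starts at a finite instant, taken as `t = 0`, and is
comparable to `exp τ` (`exists_time`). The constraint holds along the orbit because `H² (1 - y²) /
V` is conserved. Since `K → ∞` as `t → 0⁺`, no solution through the same state reaches further back.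

For the error terms, `φ + √(2/3) log t` is bounded and `log V` is Lipschitz far out, so `V (φ t)` is
at most a constant times `v t = V (-√(2/3) log t)`. The condition `√(2/3) N < 2`, equivalent to `N <
√6`, makes `t² v` and `t³ v` have derivatives bounding multiples of `t v` and `t² v`. Integrating
`(1/K - t)' = -3V/K²` and then `φ̇ + √(2/3)/t` against them (`exists_abs_sub_le_of_abs_deriv_le`)
gives the asymptotics in `hasMasslessAsymptotics`. -/

namespace FRW

open scoped NNReal

/-! ### Tools for ordinary differential equations and comparison -/

/-- A bounded, globally Lipschitz vector field has global integral curves. -/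
theorem exists_global_solution {E : Type*} [NormedAddCommGroup E] [NormedSpace ℝ E]
    [CompleteSpace E] {v : E → E} {K C : ℝ≥0} (hv : LipschitzWith K v) (hC : ∀ x, ‖v x‖ ≤ C)
    (p : E) : ∃ γ : ℝ → E, γ 0 = p ∧ ∀ t, HasDerivAt γ (v (γ t)) t := by
  have local_sol : ∀ n : ℕ, ∃ α : ℝ → E, α 0 = p ∧
      ∀ t ∈ Ioo (-(n + 1 : ℝ)) (n + 1), HasDerivAt α (v (α t)) t := by
    intro n
    have hn : (0 : ℝ) < n + 1 := by positivity
    have h0 : (0 : ℝ) ∈ Icc (-(n + 1 : ℝ)) (n + 1) := ⟨by linarith, hn.le⟩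
    -- With speed at most `C`, a ball of radius `C (n + 1)` confines the solution for the whole
    -- interval, so no smallness of time is needed.
    have hPL : IsPicardLindelof (fun _ => v) (⟨0, h0⟩ : Icc (-(n + 1 : ℝ)) (n + 1)) p
        (C * (n + 1)) 0 C K :=
      { lipschitzOnWith := fun _ _ => hv.lipschitzOnWith
        continuousOn := fun _ _ => continuousOn_const
        norm_le := fun _ _ x _ => hC x
        mul_max_le := by simp }
    obtain ⟨α, h1, h2⟩ := hPL.exists_eq_forall_mem_Icc_hasDerivWithinAt₀
    exact ⟨α, h1, fun t ht => (h2 t (Ioo_subset_Icc_self ht)).hasDerivAt (Icc_mem_nhds ht.1 ht.2)⟩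
  choose α hα0 hα using local_sol
  have agree' : ∀ m n : ℕ, m ≤ n → ∀ s ∈ Ioo (-(m + 1 : ℝ)) (m + 1), α m s = α n s := by
    intro m n hmn
    have hmn' : (m : ℝ) ≤ n := by exact_mod_cast hmn
    have hm : (0 : ℝ) < m + 1 := by positivity
    refine ODE_solution_unique_of_mem_Ioo (v := fun _ => v) (s := fun _ => univ) (t₀ := 0) (K := K)
      (fun _ _ => hv.lipschitzOnWith) ⟨by linarith, hm⟩
      (fun t ht => ⟨hα m t ht, mem_univ _⟩) (fun t ht => ⟨hα n t ?_, mem_univ _⟩) ?_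
    · exact ⟨by linarith [ht.1], by linarith [ht.2]⟩
    · rw [hα0, hα0]
  have agree : ∀ m n : ℕ, ∀ s : ℝ, |s| < m + 1 → |s| < n + 1 → α m s = α n s := by
    intro m n s hm hn
    rcases le_total m n with h | h
    · exact agree' m n h s (abs_lt.1 hm)
    · exact (agree' n m h s (abs_lt.1 hn)).symm
  have self_lt : ∀ s : ℝ, |s| < (⌈|s|⌉₊ : ℝ) + 1 := fun s => by
    linarith [Nat.le_ceil |s|]
  -- The pieces are glued by using at time `s` one whose open interval contains `s`.
  refine ⟨fun s => α ⌈|s|⌉₊ s, hα0 _, fun t => ?_⟩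
  refine (hα ⌈|t|⌉₊ t (abs_lt.1 (self_lt t))).congr_of_eventuallyEq ?_
  filter_upwards [continuous_abs.continuousAt.eventually_lt continuousAt_const (self_lt t)]
    with s hs
  exact agree _ _ s (self_lt s) hs

/-- A solution of `|x'| ≤ L |x|` that vanishes once vanishes identically. -/
theorem eq_zero_of_abs_deriv_le {x x' : ℝ → ℝ} {L : ℝ} (hx : ∀ t, HasDerivAt x (x' t) t)
    (hL : ∀ t, |x' t| ≤ L * |x t|) {s : ℝ} (hs : x s = 0) (t : ℝ) : x t = 0 := by
  rcases le_total s t with h | h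
  · exact eq_zero_of_abs_deriv_le_mul_abs_self_of_eq_zero_right (f' := x') (K := L)
      (fun r _ => (hx r).continuousAt.continuousWithinAt)
      (fun r _ => (hx r).hasDerivWithinAt) hs (fun r _ => hL r) t ⟨h, le_rfl⟩
  · have hneg : ∀ r, HasDerivAt (fun r => x (-r)) (-x' (-r)) r := fun r => by
      simpa [Function.comp_def] using (hx (-r)).comp r (hasDerivAt_neg r)
    have := eq_zero_of_abs_deriv_le_mul_abs_self_of_eq_zero_right (f := fun r => x (-r))
      (f' := fun r => -x' (-r)) (K := L) (a := -s) (b := -t)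
      (fun r _ => (hneg r).continuousAt.continuousWithinAt)
      (fun r _ => (hneg r).hasDerivWithinAt) (by simpa using hs)
      (fun r _ => by simpa using hL (-r)) (-t) ⟨by linarith, le_rfl⟩
    simpa using this

theorem pos_of_abs_deriv_le {x x' : ℝ → ℝ} {L : ℝ} (hx : ∀ t, HasDerivAt x (x' t) t)
    (hL : ∀ t, |x' t| ≤ L * |x t|) {s : ℝ} (hs : 0 < x s) (t : ℝ) : 0 < x t := by
  by_contra! h
  have hcont : ContinuousOn x (uIcc t s) := fun r _ => (hx r).continuousAt.continuousWithinAt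
  obtain ⟨r, -, hr⟩ := intermediate_value_uIcc hcont (mem_uIcc_of_le h hs.le)
  exact hs.ne' (eq_zero_of_abs_deriv_le hx hL hr s)

theorem nonneg_of_abs_deriv_le {x x' : ℝ → ℝ} {L : ℝ} (hx : ∀ t, HasDerivAt x (x' t) t)
    (hL : ∀ t, |x' t| ≤ L * |x t|) {s : ℝ} (hs : 0 ≤ x s) (t : ℝ) : 0 ≤ x t := by
  rcases hs.eq_or_lt with h | h
  · exact (eq_zero_of_abs_deriv_le hx hL h.symm t).ge
  · exact (pos_of_abs_deriv_le hx hL h t).le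

/-- If `|h'| ≤ C g'` near the left end of an interval and `g ≥ 0`, then `h` is within `C g` of a
constant. -/
theorem exists_abs_sub_le_of_abs_deriv_le {h h' g g' : ℝ → ℝ} {C b : ℝ} (hC : 0 ≤ C)
    (hb : 0 < b)
    (hh : ∀ t ∈ Ioo 0 b, HasDerivAt h (h' t) t) (hg : ∀ t ∈ Ioo 0 b, HasDerivAt g (g' t) t)
    (hg0 : ∀ t ∈ Ioo 0 b, 0 ≤ g t) (hle : ∀ t ∈ Ioo 0 b, |h' t| ≤ C * g' t) :
    ∃ l, ∀ t ∈ Ioo 0 b, |h t - l| ≤ C * g t := by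
  -- `h + C g` increases and `h - C g` decreases, so with `g ≥ 0` every value of the second lies
  -- below every value of the first. Any number separating them serves as the constant; the infimum
  -- is chosen.
  have hmono : MonotoneOn (fun t => h t + C * g t) (Ioo 0 b) := by
    refine monotoneOn_of_hasDerivWithinAt_nonneg (f' := fun t => h' t + C * g' t)
      (convex_Ioo 0 b) (fun t ht => ?_) (fun t ht => ?_) (fun t ht => ?_)
    · exact ((hh t ht).add ((hg t ht).const_mul C)).continuousAt.continuousWithinAt
    · rw [interior_Ioo] at ht
      exact ((hh t ht).add ((hg t ht).const_mul C)).hasDerivWithinAt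
    · rw [interior_Ioo] at ht
      linarith [neg_abs_le (h' t), hle t ht]
  have hanti : AntitoneOn (fun t => h t - C * g t) (Ioo 0 b) := by
    refine antitoneOn_of_hasDerivWithinAt_nonpos (f' := fun t => h' t - C * g' t)
      (convex_Ioo 0 b) (fun t ht => ?_) (fun t ht => ?_) (fun t ht => ?_)
    · exact ((hh t ht).sub ((hg t ht).const_mul C)).continuousAt.continuousWithinAt
    · rw [interior_Ioo] at ht
      exact ((hh t ht).sub ((hg t ht).const_mul C)).hasDerivWithinAt
    · rw [interior_Ioo] at ht
      linarith [le_abs_self (h' t), hle t ht]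
  have key : ∀ s ∈ Ioo 0 b, ∀ t ∈ Ioo 0 b, h t - C * g t ≤ h s + C * g s := by
    intro s hs t ht
    have h1 := mul_nonneg hC (hg0 s hs)
    have h2 := mul_nonneg hC (hg0 t ht)
    rcases le_total s t with hst | hst
    · have := hanti hs ht hst
      simp only at this
      linarith
    · have := hmono ht hs hst
      simp only at this
      linarith
  have hne : ((fun t => h t + C * g t) '' Ioo 0 b).Nonempty := (nonempty_Ioo.2 hb).image _
  have hlow : ∀ t ∈ Ioo 0 b,
      h t - C * g t ∈ lowerBounds ((fun t => h t + C * g t) '' Ioo 0 b) := by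
    rintro t ht _ ⟨s, hs, rfl⟩
    exact key s hs t ht
  obtain ⟨t₀, ht₀⟩ := nonempty_Ioo.2 hb
  refine ⟨sInf ((fun t => h t + C * g t) '' Ioo 0 b), fun t ht => abs_le.2 ⟨?_, ?_⟩⟩
  · have := csInf_le ⟨_, hlow t₀ ht₀⟩ (mem_image_of_mem _ ht)
    linarith
  · have := le_csInf hne (hlow t ht)
    linarith

/-! ### The coordinate `z = f φ` and the regularity of the extended field -/

namespace IsCoordinate

variable {k : ℕ} {V f : ℝ → ℝ} {N φ₀ ε : ℝ}

theorem f_pos (hf : IsCoordinate k V N f φ₀) {φ : ℝ} (hφ : φ₀ ≤ φ) : 0 < f φ :=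
  (hf.image_eq ▸ mem_image_of_mem f hφ : f φ ∈ Ioc 0 (f φ₀)).1

theorem f_le (hf : IsCoordinate k V N f φ₀) {φ : ℝ} (hφ : φ₀ ≤ φ) : f φ ≤ f φ₀ :=
  (hf.image_eq ▸ mem_image_of_mem f hφ : f φ ∈ Ioc 0 (f φ₀)).2

theorem bar_apply (hf : IsCoordinate k V N f φ₀) (g : ℝ → ℝ) {φ : ℝ} (hφ : φ₀ ≤ φ) :
    bar f φ₀ g (f φ) = g φ := by
  rw [bar, if_pos (hf.f_pos hφ), hf.strictAntiOn.injOn.leftInvOn_invFunOn hφ]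

theorem Wbar_apply (hf : IsCoordinate k V N f φ₀) {φ : ℝ} (hφ : φ₀ ≤ φ) :
    Wbar V N f φ₀ (f φ) = WV V N φ :=
  hf.bar_apply _ hφ

theorem hasDerivAt_f (hf : IsCoordinate k V N f φ₀) {φ : ℝ} (hφ : φ₀ < φ) :
    HasDerivAt f (fbar f φ₀ (f φ)) φ := by
  rw [fbar, hf.bar_apply _ hφ.le]
  have h : DifferentiableWithinAt ℝ f (Ici φ₀) φ :=
    (hf.contDiffOn.differentiableOn (by positivity)) φ hφ.le
  exact h.hasDerivWithinAt.hasDerivAt (Ici_mem_nhds hφ)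

/-- By the mean value theorem `f (φ + 1) - f φ`, which tends to `0`, is a value of `f'` at a point
that goes to infinity with `φ`; continuity of `fbar` at `0` identifies the limit. -/
theorem fbar_zero (hf : IsCoordinate k V N f φ₀) : fbar f φ₀ 0 = 0 := by
  have h0 : (0 : ℝ) ∈ Icc 0 (f φ₀) := ⟨le_rfl, (hf.f_pos le_rfl).le⟩
  have hmem : ∀ᶠ φ in atTop, f φ ∈ Icc 0 (f φ₀) := by
    filter_upwards [eventually_ge_atTop φ₀] with φ hφ
    exact ⟨(hf.f_pos hφ).le, hf.f_le hφ⟩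
  have hlim : Tendsto (fun φ => fbar f φ₀ (f φ)) atTop (𝓝 (fbar f φ₀ 0)) :=
    (hf.contDiffOn_fbar.continuousOn 0 h0).tendsto.comp
      (tendsto_nhdsWithin_iff.2 ⟨hf.tendsto_zero, hmem⟩)
  have hmv : ∀ φ, φ₀ < φ → ∃ ξ ∈ Ioo φ (φ + 1), fbar f φ₀ (f ξ) = f (φ + 1) - f φ := by
    intro φ hφ
    obtain ⟨ξ, hξ, h⟩ := exists_hasDerivAt_eq_slope f (fun x => fbar f φ₀ (f x))
      (by linarith : φ < φ + 1)
      (fun x hx => (hf.hasDerivAt_f (hφ.trans_le hx.1)).continuousAt.continuousWithinAt)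
      (fun x hx => hf.hasDerivAt_f (hφ.trans hx.1))
    exact ⟨ξ, hξ, by simpa using h⟩
  choose! ξ hξ hξ' using hmv
  have hξtop : Tendsto ξ atTop atTop :=
    tendsto_atTop_mono' _ ((eventually_gt_atTop φ₀).mono fun φ hφ => (hξ φ hφ).1.le) tendsto_id
  have h1 : Tendsto (fun φ => f (φ + 1) - f φ) atTop (𝓝 (fbar f φ₀ 0)) :=
    (hlim.comp hξtop).congr' ((eventually_gt_atTop φ₀).mono hξ')
  have h2 : Tendsto (fun φ => f (φ + 1) - f φ) atTop (𝓝 (0 - 0)) :=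
    (hf.tendsto_zero.comp (tendsto_atTop_add_const_right _ 1 tendsto_id)).sub hf.tendsto_zero
  simpa using tendsto_nhds_unique h1 h2

theorem fbar_nonpos (hf : IsCoordinate k V N f φ₀) {z : ℝ} (hz : z ∈ Icc 0 (f φ₀)) :
    fbar f φ₀ z ≤ 0 := by
  rcases hz.1.eq_or_lt with h | h
  · rw [← h, hf.fbar_zero]
  · obtain ⟨φ, hφ, rfl⟩ : z ∈ f '' Ici φ₀ := hf.image_eq ▸ ⟨h, hz.2⟩
    rw [fbar, hf.bar_apply _ hφ]
    exact hf.strictAntiOn.antitoneOn.derivWithin_nonpos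

theorem exists_lipschitzOnWith_fbar (hf : IsCoordinate k V N f φ₀) (hk : k ≠ 0) :
    ∃ L : ℝ≥0, LipschitzOnWith L (fbar f φ₀) (Icc 0 (f φ₀)) :=
  hf.contDiffOn_fbar.exists_lipschitzOnWith (by exact_mod_cast hk) (convex_Icc _ _) isCompact_Icc

theorem contDiffOn_field (hf : IsCoordinate k V N f φ₀) (hφε : φ₀ ≤ ε⁻¹) :
    ContDiffOn ℝ k (field V N f φ₀) (closedRegion f ε) := by
  have hmaps : MapsTo Prod.snd (closedRegion f ε) (Icc 0 (f φ₀)) :=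
    fun p hp => ⟨hp.2.1, hp.2.2.trans (hf.f_le hφε)⟩
  have hW : ContDiffOn ℝ k (fun p : ℝ × ℝ => Wbar V N f φ₀ p.2) (closedRegion f ε) :=
    hf.contDiffOn_Wbar.comp contDiff_snd.contDiffOn hmaps
  have hF : ContDiffOn ℝ k (fun p : ℝ × ℝ => fbar f φ₀ p.2) (closedRegion f ε) :=
    hf.contDiffOn_fbar.comp contDiff_snd.contDiffOn hmaps
  have h1 : ContDiffOn ℝ k (fun p : ℝ × ℝ => p.1) (closedRegion f ε) := contDiff_fst.contDiffOn
  unfold field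
  fun_prop

theorem exists_lipschitzOnWith_field (hf : IsCoordinate k V N f φ₀) (hk : k ≠ 0)
    (hφε : φ₀ ≤ ε⁻¹) : ∃ L : ℝ≥0, LipschitzOnWith L (field V N f φ₀) (closedRegion f ε) :=
  (hf.contDiffOn_field hφε).exists_lipschitzOnWith (by exact_mod_cast hk)
    ((convex_Icc _ _).prod (convex_Icc _ _)) (isCompact_Icc.prod isCompact_Icc)

end IsCoordinate

/-! ### The repelling box at `p₋` and its past orbits -/

theorem IsWBI.Wbar_zero {V f : ℝ → ℝ} {N φ₀ : ℝ} (hV : IsWBI V N) : Wbar V N f φ₀ 0 = 0 := by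
  simp [Wbar, bar, hV.tendsto_WV.limUnder_eq]

/-- On the box `-1 ≤ y ≤ -1 + δ`, `0 ≤ z ≤ δ` the factor of `1 - y²` in `dy/dτ` is at least `κ`. -/
structure IsRepellingBox (V : ℝ → ℝ) (N : ℝ) (f : ℝ → ℝ) (φ₀ ε κ δ : ℝ) : Prop where
  κ_pos : 0 < κ
  δ_pos : 0 < δ
  δ_le : δ ≤ 1
  δ_lt : δ < f ε⁻¹
  le : ∀ y ∈ Icc (-1) (-1 + δ), ∀ z ∈ Icc 0 δ, κ ≤ -(y + 1 / √6 * (Wbar V N f φ₀ z + N))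

/-- The value at `p₋` is `1 - N/√6 = 3η`. Moving `y` and moving `z` cost at most `η` each, which
leaves `κ = η`. -/
theorem exists_isRepellingBox {V f : ℝ → ℝ} {N φ₀ ε : ℝ} {k : ℕ} (hV : IsWBI V N)
    (hf : IsCoordinate k V N f φ₀) (hN : N ^ 2 < 6) (hφε : φ₀ ≤ ε⁻¹) :
    ∃ κ δ, IsRepellingBox V N f φ₀ ε κ δ := by
  have hfε := hf.f_pos hφε
  have hN6 : N < √6 := Real.lt_sqrt_of_sq_lt hN
  have h6 : 0 < √6 := by positivity
  have hη : 0 < (1 - N / √6) / 3 := by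
    have := (div_lt_one h6).2 hN6
    linarith
  set η := (1 - N / √6) / 3 with hηdef
  have hcont : ContinuousWithinAt (Wbar V N f φ₀) (Icc 0 (f φ₀)) 0 :=
    hf.contDiffOn_Wbar.continuousOn 0 ⟨le_rfl, (hf.f_pos le_rfl).le⟩
  have hlim : Tendsto (fun z => 1 / √6 * Wbar V N f φ₀ z) (𝓝[Icc 0 (f φ₀)] 0) (𝓝 0) := by
    have := hcont.tendsto.const_mul (1 / √6)
    rwa [hV.Wbar_zero, mul_zero] at this
  obtain ⟨r, hr, hball⟩ := Metric.mem_nhdsWithin_iff.1 (hlim.eventually_lt_const hη)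
  refine ⟨η, min (min 1 η) (min (f ε⁻¹ / 2) (r / 2)), hη, by positivity,
    (min_le_left _ _).trans (min_le_left _ _), ?_, fun y hy z hz => ?_⟩
  · exact ((min_le_right _ _).trans (min_le_left _ _)).trans_lt (by linarith)
  · have h1 : y ≤ -1 + η :=
      hy.2.trans (by gcongr; exact (min_le_left _ _).trans (min_le_right _ _))
    have h2 : z ≤ r / 2 := hz.2.trans ((min_le_right _ _).trans (min_le_right _ _))
    have h3 : z ≤ f ε⁻¹ / 2 := hz.2.trans ((min_le_right _ _).trans (min_le_left _ _))
    have h4 := hf.f_le hφε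
    have : 1 / √6 * Wbar V N f φ₀ z < η := by
      refine hball ⟨?_, hz.1, by linarith⟩
      rw [Metric.mem_ball, Real.dist_eq, sub_zero, abs_of_nonneg hz.1]
      linarith
    have h5 : 1 / √6 * N = N / √6 := by ring
    rw [mul_add, h5]
    linarith

/-- `γ` is a trajectory on the times `τ ≤ 0` that stays in the box. -/
structure IsPastOrbit (V : ℝ → ℝ) (N : ℝ) (f : ℝ → ℝ) (φ₀ δ : ℝ) (γ : ℝ → ℝ × ℝ) : Prop where
  continuous : Continuous γ
  hasDerivAt : ∀ τ ≤ 0, HasDerivAt γ (field V N f φ₀ (γ τ)) τ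
  fst_mem : ∀ τ ≤ 0, (γ τ).1 ∈ Icc (-1) (-1 + δ)
  snd_mem : ∀ τ ≤ 0, (γ τ).2 ∈ Icc 0 δ
  fst_gt : -1 < (γ 0).1 → ∀ τ ≤ 0, -1 < (γ τ).1
  snd_eq : (γ 0).2 = 0 → ∀ τ ≤ 0, (γ τ).2 = 0

/-- The field is composed with the projection onto the box, which makes it globally Lipschitz and
bounded. The resulting global curve stays in the box for `τ ≤ 0`, where the projection is the
identity, so there it solves the original system. -/
theorem exists_isPastOrbit {V f : ℝ → ℝ} {N φ₀ ε κ δ : ℝ} {k : ℕ} (hk : k ≠ 0)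
    (hf : IsCoordinate k V N f φ₀) (hφε : φ₀ ≤ ε⁻¹) (hbox : IsRepellingBox V N f φ₀ ε κ δ)
    {p : ℝ × ℝ} (hp : p.1 ∈ Icc (-1) (-1 + δ)) (hp' : p.2 ∈ Icc 0 δ) :
    ∃ γ, γ 0 = p ∧ IsPastOrbit V N f φ₀ δ γ := by
  obtain ⟨L, hL⟩ := hf.exists_lipschitzOnWith_field hk hφε
  have hδ := hbox.δ_pos
  have hy1 : (-1 : ℝ) ≤ -1 + δ := by linarith
  have hfε := hf.f_le hφε
  set P : ℝ × ℝ → ℝ × ℝ :=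
    fun x => (projIcc (-1) (-1 + δ) hy1 x.1, projIcc 0 δ hδ.le x.2) with hP
  have hPmem : ∀ x, (P x).1 ∈ Icc (-1) (-1 + δ) ∧ (P x).2 ∈ Icc 0 δ :=
    fun x => ⟨Subtype.prop _, Subtype.prop _⟩
  have hreg : ∀ y ∈ Icc (-1) (-1 + δ), ∀ z ∈ Icc 0 δ, (y, z) ∈ closedRegion f ε :=
    fun y hy z hz => ⟨⟨hy.1, hy.2.trans (by linarith [hbox.δ_le])⟩,
      hz.1, hz.2.trans hbox.δ_lt.le⟩
  have hPreg : ∀ x, P x ∈ closedRegion f ε := fun x => hreg _ (hPmem x).1 _ (hPmem x).2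
  have hPid : ∀ x : ℝ × ℝ, x.1 ∈ Icc (-1) (-1 + δ) → x.2 ∈ Icc 0 δ → P x = x := by
    intro x h1 h2
    simp only [hP]
    rw [projIcc_of_mem _ h1, projIcc_of_mem _ h2]
  have hPlip : LipschitzWith 1 P := by
    have h1 := (LipschitzWith.projIcc hy1).comp (LipschitzWith.prod_fst (α := ℝ) (β := ℝ))
    have h2 := (LipschitzWith.projIcc hδ.le).comp (LipschitzWith.prod_snd (α := ℝ) (β := ℝ))
    simpa using (LipschitzWith.subtype_val _ |>.comp h1).prodMk
      (LipschitzWith.subtype_val _ |>.comp h2)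
  have hvlip : LipschitzWith (L * 1) (field V N f φ₀ ∘ P) := by
    rw [← lipschitzOnWith_univ] at hPlip ⊢
    exact hL.comp hPlip fun x _ => hPreg x
  obtain ⟨C, hC⟩ := ((isCompact_Icc.prod isCompact_Icc).image_of_continuousOn
    hL.continuousOn).isBounded.exists_norm_le
  have hbound : ∀ x, ‖(field V N f φ₀ ∘ P) x‖ ≤ C.toNNReal :=
    fun x => (hC _ (mem_image_of_mem _ (hPreg x))).trans (Real.le_coe_toNNReal C)
  obtain ⟨γ, hγ0, hγ⟩ := exists_global_solution hvlip hbound p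
  have hd1 : ∀ τ, HasDerivAt (fun τ => (γ τ).1) (field V N f φ₀ (P (γ τ))).1 τ := fun τ => by
    simpa [Function.comp_def] using (hasFDerivAt_fst.comp_hasDerivAt τ (hγ τ))
  have hd2 : ∀ τ, HasDerivAt (fun τ => (γ τ).2) (field V N f φ₀ (P (γ τ))).2 τ := fun τ => by
    simpa [Function.comp_def] using (hasFDerivAt_snd.comp_hasDerivAt τ (hγ τ))
  -- The first component vanishes on `y = -1` and the second on `z = 0`. The Lipschitz bound turns
  -- this into `|x'| ≤ L |x|` for `x = y + 1` and `x = z`, so these edges cannot be crossed.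
  have hlip1 : ∀ x, |(field V N f φ₀ (P x)).1| ≤ L * |x.1 + 1| := by
    intro x
    have h := hL.dist_le_mul _ (hPreg x) _ (hreg (-1) ⟨le_rfl, hy1⟩ _ (hPmem x).2)
    have h1 : (field V N f φ₀ (-1, (P x).2)).1 = 0 := by simp [field]
    have h2 := (le_max_left _ _).trans h
    rw [h1, Real.dist_eq, sub_zero, Prod.dist_eq, dist_self, max_eq_left dist_nonneg] at h2
    refine h2.trans (mul_le_mul_of_nonneg_left ?_ L.2)
    have := ((LipschitzWith.projIcc hy1).dist_le_mul x.1 (-1))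
    rw [projIcc_left, Subtype.dist_eq, Real.dist_eq, Real.dist_eq] at this
    simpa [hP, Real.dist_eq] using this
  have hlip2 : ∀ x, |(field V N f φ₀ (P x)).2| ≤ L * |x.2| := by
    intro x
    have h := hL.dist_le_mul _ (hPreg x) _ (hreg _ (hPmem x).1 0 ⟨le_rfl, hδ.le⟩)
    have h1 : (field V N f φ₀ ((P x).1, 0)).2 = 0 := by simp [field, hf.fbar_zero]
    have h2 := (le_max_right _ _).trans h
    rw [h1, Real.dist_eq, sub_zero, Prod.dist_eq, dist_self, max_eq_right dist_nonneg] at h2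
    refine h2.trans (mul_le_mul_of_nonneg_left ?_ L.2)
    have := ((LipschitzWith.projIcc hδ.le).dist_le_mul x.2 0)
    rw [projIcc_left, Subtype.dist_eq, Real.dist_eq, Real.dist_eq] at this
    simpa [hP, Real.dist_eq] using this
  -- Monotonicity of both coordinates bars a past exit through the edges `y = -1 + δ` and `z = δ`.
  have hy_mono : Monotone fun τ => (γ τ).1 := by
    refine monotone_of_hasDerivAt_nonneg hd1 fun τ => ?_
    have h := hbox.le _ (hPmem (γ τ)).1 _ (hPmem (γ τ)).2
    have h1 := (hPmem (γ τ)).1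
    refine mul_nonneg (hbox.κ_pos.le.trans h) ?_
    nlinarith [h1.1, h1.2, hbox.δ_le]
  have hz_mono : Monotone fun τ => (γ τ).2 := by
    refine monotone_of_hasDerivAt_nonneg hd2 fun τ => ?_
    have h1 := hPmem (γ τ)
    have h2 := hf.fbar_nonpos ⟨h1.2.1, h1.2.2.trans (hbox.δ_lt.le.trans hfε)⟩
    refine mul_nonneg_of_nonpos_of_nonpos (mul_nonpos_of_nonneg_of_nonpos (by positivity) h2) ?_
    linarith [h1.1.2, hbox.δ_le]
  have hd1' : ∀ τ, HasDerivAt (fun τ => (γ τ).1 + 1) (field V N f φ₀ (P (γ τ))).1 τ :=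
    fun τ => (hd1 τ).add_const 1
  have hy_ge : ∀ τ, -1 ≤ (γ τ).1 := fun τ => by
    have := nonneg_of_abs_deriv_le hd1' (fun τ => hlip1 (γ τ)) (s := 0)
      (by rw [hγ0]; linarith [hp.1]) τ
    linarith
  have hz_ge : ∀ τ, 0 ≤ (γ τ).2 :=
    nonneg_of_abs_deriv_le hd2 (fun τ => hlip2 (γ τ)) (s := 0) (by rw [hγ0]; exact hp'.1)
  have hy_mem : ∀ τ ≤ 0, (γ τ).1 ∈ Icc (-1) (-1 + δ) := fun τ hτ =>
    ⟨hy_ge τ, (hy_mono hτ).trans (by simpa only [hγ0] using hp.2)⟩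
  have hz_mem : ∀ τ ≤ 0, (γ τ).2 ∈ Icc 0 δ := fun τ hτ =>
    ⟨hz_ge τ, (hz_mono hτ).trans (by simpa only [hγ0] using hp'.2)⟩
  refine ⟨γ, hγ0, continuous_iff_continuousAt.2 fun τ => (hγ τ).continuousAt, fun τ hτ => ?_,
    hy_mem, hz_mem, fun h τ _ => ?_, fun h τ _ => ?_⟩
  · have := hγ τ
    rwa [Function.comp, hPid _ (hy_mem τ hτ) (hz_mem τ hτ)] at this
  · have := pos_of_abs_deriv_le hd1' (fun τ => hlip1 (γ τ)) (s := 0) (by linarith) τ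
    linarith
  · exact eq_zero_of_abs_deriv_le hd2 (fun τ => hlip2 (γ τ)) h τ

theorem IsPastOrbit.isTrajectory {V f : ℝ → ℝ} {N φ₀ ε κ δ : ℝ} {γ : ℝ → ℝ × ℝ}
    (h : IsPastOrbit V N f φ₀ δ γ) (hbox : IsRepellingBox V N f φ₀ ε κ δ) :
    IsTrajectory V N f φ₀ ε (Iic 0) γ where
  mem τ hτ := ⟨⟨(h.fst_mem τ hτ).1, (h.fst_mem τ hτ).2.trans (by linarith [hbox.δ_le])⟩,
      (h.snd_mem τ hτ).1, (h.snd_mem τ hτ).2.trans hbox.δ_lt.le⟩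
  deriv τ hτ := (h.hasDerivAt τ hτ).hasDerivWithinAt

theorem IsTrajectory.eqOn {V f : ℝ → ℝ} {N φ₀ ε S : ℝ} {γ χ : ℝ → ℝ × ℝ} {k : ℕ} (hk : k ≠ 0)
    (hf : IsCoordinate k V N f φ₀) (hφε : φ₀ ≤ ε⁻¹)
    (hγ : IsTrajectory V N f φ₀ ε (Iic 0) γ) (hχ : IsTrajectory V N f φ₀ ε (Icc (-S) 0) χ)
    (h0 : χ 0 = γ 0) : EqOn χ γ (Icc (-S) 0) := by
  obtain ⟨L, hL⟩ := hf.exists_lipschitzOnWith_field hk hφε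
  refine ODE_solution_unique_of_mem_Icc_left (v := fun _ => field V N f φ₀)
    (s := fun _ => closedRegion f ε) (fun _ _ => hL)
    (fun τ hτ => (hχ.deriv τ hτ).continuousWithinAt) (fun τ hτ => ?_)
    (fun τ hτ => hχ.mem τ (Ioc_subset_Icc_self hτ))
    (fun τ hτ => (hγ.deriv τ hτ.2).continuousWithinAt.mono Icc_subset_Iic_self)
    (fun τ hτ => (hγ.deriv τ hτ.2).mono (Iic_subset_Iic.2 hτ.2))
    (fun τ hτ => hγ.mem τ hτ.2) h0
  refine (hχ.deriv τ (Ioc_subset_Icc_self hτ)).mono_of_mem_nhdsWithin ?_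
  exact mem_of_superset (Icc_mem_nhdsLE hτ.1) (Icc_subset_Icc_right hτ.2)

namespace IsPastOrbit

variable {V f : ℝ → ℝ} {N φ₀ ε κ δ : ℝ} {γ : ℝ → ℝ × ℝ}

theorem hasDerivAt_fst (h : IsPastOrbit V N f φ₀ δ γ) {τ : ℝ} (hτ : τ ≤ 0) :
    HasDerivAt (fun τ => (γ τ).1) (field V N f φ₀ (γ τ)).1 τ := by
  simpa [Function.comp_def] using (hasFDerivAt_fst.comp_hasDerivAt τ (h.hasDerivAt τ hτ))

theorem hasDerivAt_snd (h : IsPastOrbit V N f φ₀ δ γ) {τ : ℝ} (hτ : τ ≤ 0) :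
    HasDerivAt (fun τ => (γ τ).2) (field V N f φ₀ (γ τ)).2 τ := by
  simpa [Function.comp_def] using (hasFDerivAt_snd.comp_hasDerivAt τ (h.hasDerivAt τ hτ))

/-- `1 - y² = (1 - y)(1 + y) ≥ 1 + y` because `δ ≤ 1` forces `y ≤ 0`. -/
theorem mul_le_field_fst (h : IsPastOrbit V N f φ₀ δ γ) (hbox : IsRepellingBox V N f φ₀ ε κ δ)
    {τ : ℝ} (hτ : τ ≤ 0) : κ * ((γ τ).1 + 1) ≤ (field V N f φ₀ (γ τ)).1 := by
  have h1 := hbox.le _ (h.fst_mem τ hτ) _ (h.snd_mem τ hτ)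
  obtain ⟨h2, h3⟩ := h.fst_mem τ hτ
  have h4 : (γ τ).1 + 1 ≤ 1 - (γ τ).1 ^ 2 := by nlinarith [hbox.δ_le]
  exact mul_le_mul h1 h4 (by linarith) (hbox.κ_pos.le.trans h1)

/-- By the previous inequality `(y + 1) exp (-κ τ)` is nondecreasing, so `y + 1` decays
exponentially into the past. -/
theorem tendsto_fst (h : IsPastOrbit V N f φ₀ δ γ) (hbox : IsRepellingBox V N f φ₀ ε κ δ) :
    Tendsto (fun τ => (γ τ).1) atBot (𝓝 (-1)) := by
  have hκ := hbox.κ_pos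
  have hd : ∀ τ ≤ 0, HasDerivAt (fun τ => ((γ τ).1 + 1) * Real.exp (-κ * τ))
      ((field V N f φ₀ (γ τ)).1 * Real.exp (-κ * τ) +
        ((γ τ).1 + 1) * (Real.exp (-κ * τ) * (-κ))) τ := fun τ hτ => by
    have h2 : HasDerivAt (fun τ => -κ * τ) (-κ) τ := by simpa using (hasDerivAt_id τ).const_mul (-κ)
    exact ((h.hasDerivAt_fst hτ).add_const 1).mul h2.exp
  have hmono : MonotoneOn (fun τ => ((γ τ).1 + 1) * Real.exp (-κ * τ)) (Iic 0) := by
    refine monotoneOn_of_hasDerivWithinAt_nonneg (convex_Iic 0)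
      (fun τ hτ => (hd τ hτ).continuousAt.continuousWithinAt)
      (fun τ hτ => (hd τ (mem_Iic.1 (interior_subset hτ))).hasDerivWithinAt) (fun τ hτ => ?_)
    have h1 := h.mul_le_field_fst hbox (mem_Iic.1 (interior_subset hτ))
    have h2 := Real.exp_pos (-κ * τ)
    nlinarith
  have hle : ∀ τ ≤ 0, (γ τ).1 ≤ -1 + ((γ 0).1 + 1) * Real.exp (κ * τ) := fun τ hτ => by
    have := hmono hτ (mem_Iic.2 le_rfl) hτ
    simp only [mul_zero, Real.exp_zero, mul_one] at this
    have h3 := mul_le_mul_of_nonneg_right this (Real.exp_pos (κ * τ)).le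
    rw [mul_assoc, ← Real.exp_add, show -κ * τ + κ * τ = 0 by ring, Real.exp_zero] at h3
    linarith
  have hexp : Tendsto (fun τ => -1 + ((γ 0).1 + 1) * Real.exp (κ * τ)) atBot (𝓝 (-1)) := by
    have h1 : Tendsto (fun τ => Real.exp (κ * τ)) atBot (𝓝 0) :=
      Real.tendsto_exp_atBot.comp (tendsto_id.const_mul_atBot hκ)
    simpa using (h1.const_mul ((γ 0).1 + 1)).const_add (-1)
  exact tendsto_of_tendsto_of_tendsto_of_le_of_le' tendsto_const_nhds hexp
    ((eventually_le_atBot 0).mono fun τ hτ => (h.fst_mem τ hτ).1)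
    ((eventually_le_atBot 0).mono hle)

/-- A quantity whose rate of change is between `0` and `c (1 + y)` stays bounded in the past. -/
theorem bounds_of_deriv_le (h : IsPastOrbit V N f φ₀ δ γ) (hbox : IsRepellingBox V N f φ₀ ε κ δ)
    {ψ ψ' : ℝ → ℝ} {c : ℝ} (hc : 0 ≤ c) (hψ : ∀ τ ≤ 0, HasDerivAt ψ (ψ' τ) τ)
    (h0 : ∀ τ ≤ 0, 0 ≤ ψ' τ) (h1 : ∀ τ ≤ 0, ψ' τ ≤ c * ((γ τ).1 + 1)) {τ : ℝ} (hτ : τ ≤ 0) :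
    ψ 0 - c / κ ≤ ψ τ ∧ ψ τ ≤ ψ 0 := by
  have hκ := hbox.κ_pos
  constructor
  · have hd : ∀ τ ≤ 0, HasDerivAt (fun τ => ψ τ - c / κ * (γ τ).1)
        (ψ' τ - c / κ * (field V N f φ₀ (γ τ)).1) τ :=
      fun τ hτ => (hψ τ hτ).sub ((h.hasDerivAt_fst hτ).const_mul _)
    have hanti : AntitoneOn (fun τ => ψ τ - c / κ * (γ τ).1) (Iic 0) := by
      refine antitoneOn_of_hasDerivWithinAt_nonpos (convex_Iic 0)
        (fun τ hτ => (hd τ hτ).continuousAt.continuousWithinAt)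
        (fun τ hτ => (hd τ (mem_Iic.1 (interior_subset hτ))).hasDerivWithinAt) (fun τ hτ => ?_)
      have h2 := mul_le_mul_of_nonneg_left (h.mul_le_field_fst hbox (mem_Iic.1 (interior_subset hτ)))
        (div_nonneg hc hκ.le)
      rw [← mul_assoc, div_mul_cancel₀ _ hκ.ne'] at h2
      linarith [h1 τ (mem_Iic.1 (interior_subset hτ))]
    have h3 := hanti hτ (mem_Iic.2 le_rfl) hτ
    simp only at h3
    have h4 : c / κ * ((γ 0).1 - (γ τ).1) ≤ c / κ * 1 :=
      mul_le_mul_of_nonneg_left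
        (by linarith [(h.fst_mem τ hτ).1, (h.fst_mem 0 le_rfl).2, hbox.δ_le]) (by positivity)
    linarith
  · have hmono : MonotoneOn ψ (Iic 0) :=
      monotoneOn_of_hasDerivWithinAt_nonneg (convex_Iic 0)
        (fun τ hτ => (hψ τ hτ).continuousAt.continuousWithinAt)
        (fun τ hτ => (hψ τ (mem_Iic.1 (interior_subset hτ))).hasDerivWithinAt)
        (fun τ hτ => h0 τ (mem_Iic.1 (interior_subset hτ)))
    exact hmono hτ (mem_Iic.2 le_rfl) hτ

end IsPastOrbit

/-! ### Scalar field, Hubble parameter and constraint along an orbit -/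

theorem sqrt_two_thirds_sq : √(2 / 3) ^ 2 = (2 : ℝ) / 3 := Real.sq_sqrt (by norm_num)

theorem sqrt_two_thirds_pos : 0 < √(2 / 3 : ℝ) := by positivity

theorem one_div_sqrt_six : 1 / √6 = √(2 / 3) / 2 := by
  rw [show (2 / 3 : ℝ) = 2 ^ 2 / 6 by norm_num, Real.sqrt_div (by norm_num),
    Real.sqrt_sq (by norm_num)]
  ring

theorem sqrt_three_halves : √(3 / 2) = 3 / 2 * √(2 / 3 : ℝ) := by
  rw [Real.sqrt_eq_iff_mul_self_eq (by norm_num) (by positivity)]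
  linear_combination (-9 / 4) * sqrt_two_thirds_sq

theorem IsCoordinate.Wbar_add {k : ℕ} {V f : ℝ → ℝ} {N φ₀ φ : ℝ} (hf : IsCoordinate k V N f φ₀)
    (hφ : φ₀ ≤ φ) : Wbar V N f φ₀ (f φ) + N = deriv V φ / V φ := by
  rw [hf.Wbar_apply hφ, WV]
  ring

namespace IsPastOrbit

variable {V f : ℝ → ℝ} {N φ₀ ε κ δ : ℝ} {γ : ℝ → ℝ × ℝ} {k : ℕ}

theorem continuous_fst (h : IsPastOrbit V N f φ₀ δ γ) : Continuous fun τ => (γ τ).1 :=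
  _root_.continuous_fst.comp h.continuous

/-- The scalar field along a trajectory that starts away from `z = 0`. -/
theorem exists_scalar (h : IsPastOrbit V N f φ₀ δ γ) (hbox : IsRepellingBox V N f φ₀ ε κ δ)
    (hk : k ≠ 0) (hf : IsCoordinate k V N f φ₀) (hφε : φ₀ ≤ ε⁻¹) {φ₁ : ℝ} (hφ₁ : φ₀ < φ₁)
    (hγ0 : f φ₁ = (γ 0).2) :
    ∃ φ : ℝ → ℝ, φ 0 = φ₁ ∧ (∀ τ, HasDerivAt φ (√(2 / 3) * (γ τ).1) τ) ∧
      (∀ τ ≤ 0, φ₁ ≤ φ τ) ∧ (∀ τ ≤ 0, f (φ τ) = (γ τ).2) ∧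
      ∃ C, ∀ τ ≤ 0, |φ τ + √(2 / 3) * τ| ≤ C := by
  have hr := sqrt_two_thirds_pos
  set r := √(2 / 3 : ℝ) with hrdef
  have hcont : Continuous fun τ => r * (γ τ).1 := continuous_const.mul h.continuous_fst
  obtain ⟨φ, hφ0, hφ⟩ : ∃ φ : ℝ → ℝ, φ 0 = φ₁ ∧ ∀ τ, HasDerivAt φ (r * (γ τ).1) τ :=
    ⟨fun τ => φ₁ + ∫ s in (0 : ℝ)..τ, r * (γ s).1, by simp,
      fun τ => (hcont.integral_hasStrictDerivAt 0 τ).hasDerivAt.const_add φ₁⟩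
  have hφge : ∀ τ ≤ 0, φ₁ ≤ φ τ := by
    have hanti : AntitoneOn φ (Iic 0) :=
      antitoneOn_of_hasDerivWithinAt_nonpos (convex_Iic 0)
        (fun τ _ => (hφ τ).continuousAt.continuousWithinAt)
        (fun τ _ => (hφ τ).hasDerivWithinAt)
        (fun τ hτ => mul_nonpos_of_nonneg_of_nonpos hr.le (by
          linarith [(h.fst_mem τ (mem_Iic.1 (interior_subset hτ))).2, hbox.δ_le]))
    exact fun τ hτ => hφ0 ▸ hanti hτ (mem_Iic.2 le_rfl) hτ
  refine ⟨φ, hφ0, hφ, hφge, fun τ hτ => ?_, ?_⟩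
  · obtain ⟨L, hL⟩ := hf.exists_lipschitzOnWith_fbar hk
    have hφgt : ∀ s ≤ 0, φ₀ < φ s := fun s hs => hφ₁.trans_le (hφge s hs)
    have hd1 : ∀ s ≤ 0, HasDerivAt (fun s => f (φ s))
        (r * fbar f φ₀ (f (φ s)) * (γ s).1) s := fun s hs => by
      exact ((hf.hasDerivAt_f (hφgt s hs)).comp s (hφ s)).congr_deriv (by ring)
    have hd2 : ∀ s ≤ 0, HasDerivAt (fun s => (γ s).2)
        (r * fbar f φ₀ ((γ s).2) * (γ s).1) s := fun s hs => h.hasDerivAt_snd hs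
    have hr1 : r ≤ 1 := Real.sqrt_le_one.2 (by norm_num)
    -- With `y` regarded as given, `f ∘ φ` and `z` solve the same scalar equation with the same
    -- value at `0`.
    have heq : EqOn (fun s => f (φ s)) (fun s => (γ s).2) (Icc τ 0) := by
      refine ODE_solution_unique_of_mem_Icc_left
        (v := fun s w => r * fbar f φ₀ w * (γ s).1)
        (s := fun _ => Icc 0 (f φ₀)) (K := L) (fun s hs => ?_)
        (fun s hs => (hd1 s hs.2).continuousAt.continuousWithinAt)
        (fun s hs => (hd1 s hs.2).hasDerivWithinAt)
        (fun s hs => ⟨(hf.f_pos (hφgt s hs.2).le).le, hf.f_le (hφgt s hs.2).le⟩)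
        (fun s hs => (hd2 s hs.2).continuousAt.continuousWithinAt)
        (fun s hs => (hd2 s hs.2).hasDerivWithinAt)
        (fun s hs => ⟨(h.snd_mem s hs.2).1,
          (h.snd_mem s hs.2).2.trans (hbox.δ_lt.le.trans (hf.f_le hφε))⟩)
        (by simpa only [hφ0] using hγ0)
      refine LipschitzOnWith.of_dist_le_mul fun w hw w' hw' => ?_
      have hy : |(γ s).1| ≤ 1 := abs_le.2
        ⟨(h.fst_mem s hs.2).1, by linarith [(h.fst_mem s hs.2).2, hbox.δ_le]⟩
      have h1 := hL.dist_le_mul w hw w' hw'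
      rw [Real.dist_eq] at h1 ⊢
      rw [show r * fbar f φ₀ w * (γ s).1 - r * fbar f φ₀ w' * (γ s).1 =
        r * (γ s).1 * (fbar f φ₀ w - fbar f φ₀ w') by ring, abs_mul, abs_mul, abs_of_pos hr]
      refine le_trans ?_ h1
      exact mul_le_of_le_one_left (abs_nonneg _) (mul_le_one₀ hr1 (abs_nonneg _) hy)
    exact heq ⟨le_rfl, hτ⟩
  · have hb := fun τ (hτ : τ ≤ 0) => h.bounds_of_deriv_le hbox (ψ := fun τ => φ τ + r * τ)
      (ψ' := fun τ => r * (γ τ).1 + r) hr.le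
      (fun τ _ => (hφ τ).add (by simpa using (hasDerivAt_id τ).const_mul r))
      (fun τ hτ => by nlinarith [(h.fst_mem τ hτ).1]) (fun τ _ => by linarith) hτ
    simp only [hφ0, mul_zero, add_zero] at hb
    refine ⟨|φ₁| + r / κ, fun τ hτ => abs_le.2 ⟨?_, ?_⟩⟩
    · linarith [(hb τ hτ).1, neg_abs_le φ₁]
    · have := hbox.κ_pos
      linarith [(hb τ hτ).2, le_abs_self φ₁, div_nonneg hr.le this.le]

/-- An orbit with `z = 0` stays there. Otherwise the reconstructed `φ` grows like `-√(2/3) τ`, and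
`z = f φ → 0`. -/
theorem tendsto (h : IsPastOrbit V N f φ₀ δ γ) (hbox : IsRepellingBox V N f φ₀ ε κ δ)
    (hk : k ≠ 0) (hf : IsCoordinate k V N f φ₀) (hφε : φ₀ ≤ ε⁻¹) :
    Tendsto γ atBot (𝓝 pMinus) := by
  refine (h.tendsto_fst hbox).prodMk_nhds ?_
  obtain ⟨h1, h2⟩ := h.snd_mem 0 le_rfl
  rcases h1.eq_or_lt with h0 | h0
  · exact tendsto_const_nhds.congr'
      ((eventually_le_atBot 0).mono fun τ hτ => (h.snd_eq h0.symm τ hτ).symm)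
  · obtain ⟨φ₁, hφ₁, hφ₁'⟩ : (γ 0).2 ∈ f '' Ici φ₀ :=
      hf.image_eq ▸ ⟨h0, h2.trans (hbox.δ_lt.le.trans (hf.f_le hφε))⟩
    -- `exists_scalar` needs strict inequality, since `f` is differentiated from both sides.
    have hne : φ₁ ≠ φ₀ := by
      rintro rfl
      linarith [hf.f_le hφε, hbox.δ_lt]
    obtain ⟨φ, -, -, -, hφ, C, hC⟩ :=
      h.exists_scalar hbox hk hf hφε (lt_of_le_of_ne hφ₁ hne.symm) hφ₁'
    have htop : Tendsto φ atBot atTop := by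
      have h3 : Tendsto (fun τ : ℝ => -√(2 / 3) * τ + -C) atBot atTop :=
        tendsto_atTop_add_const_right _ _
          (tendsto_id.const_mul_atBot_of_neg (neg_lt_zero.2 sqrt_two_thirds_pos))
      refine tendsto_atTop_mono' _ ((eventually_le_atBot 0).mono fun τ hτ => ?_) h3
      linarith [(abs_le.1 (hC τ hτ)).1]
    exact (hf.tendsto_zero.comp htop).congr' ((eventually_le_atBot 0).mono hφ)

/-- The Hubble parameter along a trajectory. -/
theorem exists_hubble (h : IsPastOrbit V N f φ₀ δ γ) (hbox : IsRepellingBox V N f φ₀ ε κ δ)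
    {K₁ : ℝ} (hK₁ : 0 < K₁) :
    ∃ H : ℝ → ℝ, H 0 = K₁ ∧ (∀ τ, 0 < H τ) ∧ (∀ τ, HasDerivAt H (-(γ τ).1 ^ 2 * H τ) τ) ∧
      ∃ a > 0, ∃ b > 0, ∀ τ ≤ 0, a * Real.exp τ ≤ (H τ)⁻¹ ∧ (H τ)⁻¹ ≤ b * Real.exp τ := by
  have hcont : Continuous fun τ => (γ τ).1 ^ 2 := h.continuous_fst.pow 2
  set G : ℝ → ℝ := fun τ => Real.log K₁ - ∫ s in (0 : ℝ)..τ, (γ s).1 ^ 2 with hG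
  have hGd : ∀ τ, HasDerivAt G (-(γ τ).1 ^ 2) τ := fun τ =>
    (hcont.integral_hasStrictDerivAt 0 τ).hasDerivAt.const_sub _
  have hG0 : G 0 = Real.log K₁ := by simp [hG]
  -- `log H + τ` has derivative `1 - y²`, which lies between `0` and `2 (1 + y)`.
  have hb := fun τ (hτ : τ ≤ 0) => h.bounds_of_deriv_le hbox (ψ := fun τ => G τ + τ)
    (ψ' := fun τ => -(γ τ).1 ^ 2 + 1) (c := 2) (by norm_num)
    (fun τ _ => (hGd τ).add (hasDerivAt_id τ))
    (fun τ hτ => by nlinarith [(h.fst_mem τ hτ).1, (h.fst_mem τ hτ).2, hbox.δ_le])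
    (fun τ hτ => by nlinarith [(h.fst_mem τ hτ).1, (h.fst_mem τ hτ).2, hbox.δ_le]) hτ
  simp only [hG0, add_zero] at hb
  refine ⟨fun τ => Real.exp (G τ), by simp only [hG0, Real.exp_log hK₁],
    fun τ => Real.exp_pos _, fun τ => ?_, Real.exp (-Real.log K₁), Real.exp_pos _,
    Real.exp (2 / κ - Real.log K₁), Real.exp_pos _, fun τ hτ => ?_⟩
  · convert (hGd τ).exp using 1
    ring
  · obtain ⟨h1, h2⟩ := hb τ hτ
    rw [← Real.exp_neg, ← Real.exp_add, ← Real.exp_add, Real.exp_le_exp, Real.exp_le_exp]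
    constructor <;> linarith

/-- The Friedmann constraint propagates. -/
theorem constraint (h : IsPastOrbit V N f φ₀ δ γ) (hf : IsCoordinate k V N f φ₀)
    (hV : IsWBI V N) {φ H : ℝ → ℝ}
    (hφ : ∀ τ, HasDerivAt φ (√(2 / 3) * (γ τ).1) τ) (hφge : ∀ τ ≤ 0, φ₀ ≤ φ τ)
    (hφf : ∀ τ ≤ 0, f (φ τ) = (γ τ).2) (hH : ∀ τ, HasDerivAt H (-(γ τ).1 ^ 2 * H τ) τ)
    (h0 : H 0 ^ 2 * (1 - (γ 0).1 ^ 2) = 3 * V (φ 0)) {τ : ℝ} (hτ : τ ≤ 0) :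
    H τ ^ 2 * (1 - (γ τ).1 ^ 2) = 3 * V (φ τ) := by
  have hVpos : ∀ s ≤ 0, V (φ s) ≠ 0 := fun s hs => (hf.V_pos _ (hφge s hs)).ne'
  have hd : ∀ s ≤ 0, HasDerivAt (fun s => H s ^ 2 * (1 - (γ s).1 ^ 2) / V (φ s)) 0 s := by
    intro s hs
    have hVd : HasDerivAt V (deriv V (φ s)) (φ s) :=
      (hV.contDiff.differentiable (by norm_num) _).hasDerivAt
    have hne := hVpos s hs
    refine ((((hH s).pow 2).mul (((h.hasDerivAt_fst hs).pow 2).const_sub 1)).div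
      (hVd.comp s (hφ s)) hne).congr_deriv ?_
    simp only [Pi.mul_apply, Pi.pow_apply, field, ← hφf s hs, hf.Wbar_add (hφge s hs), one_div_sqrt_six, Function.comp]
    field_simp
    ring
  have hc := constant_of_has_deriv_right_zero (a := τ) (b := 0)
    (fun s hs => (hd s hs.2).continuousAt.continuousWithinAt)
    (fun s hs => (hd s hs.2.le).hasDerivWithinAt) 0 ⟨hτ, le_rfl⟩
  rw [h0, mul_div_cancel_right₀ _ (hVpos 0 le_rfl), eq_div_iff (hVpos τ hτ)] at hc
  exact hc.symm

end IsPastOrbit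

/-! ### Physical time -/

/-- The physical time `t`, with `dt/dτ = 1/H`, starts at a finite value: `τ` as a function `θ` of
`t ∈ (0, T]`. -/
theorem exists_time {H : ℝ → ℝ} {a b : ℝ} (ha : 0 < a) (hcont : Continuous H)
    (hpos : ∀ τ, 0 < H τ) (hlow : ∀ τ ≤ 0, a * Real.exp τ ≤ (H τ)⁻¹)
    (hup : ∀ τ ≤ 0, (H τ)⁻¹ ≤ b * Real.exp τ) :
    ∃ T > 0, ∃ θ : ℝ → ℝ, θ T = 0 ∧ (∀ t ∈ Ioc 0 T, θ t ≤ 0 ∧ HasDerivAt θ (H (θ t)) t ∧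
      a * Real.exp (θ t) ≤ t ∧ t ≤ b * Real.exp (θ t)) ∧ Tendsto θ (𝓝[>] 0) atBot := by
  have hinv : Continuous fun τ => (H τ)⁻¹ := hcont.inv₀ fun τ => (hpos τ).ne'
  set s : ℝ → ℝ := fun τ => ∫ x in (0 : ℝ)..τ, (H x)⁻¹ with hs
  have hsd : ∀ τ, HasStrictDerivAt s (H τ)⁻¹ τ := fun τ => hinv.integral_hasStrictDerivAt 0 τ
  have hs0 : s 0 = 0 := by simp [hs]
  have hsmono : StrictMono s := strictMono_of_hasDerivAt_pos (fun τ => (hsd τ).hasDerivAt)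
    fun τ => inv_pos.2 (hpos τ)
  have hed : ∀ c τ : ℝ, HasDerivAt (fun τ => c * Real.exp τ) (c * Real.exp τ) τ :=
    fun c τ => (Real.hasDerivAt_exp τ).const_mul c
  have hanti : AntitoneOn (fun τ => s τ - b * Real.exp τ) (Iic 0) :=
    antitoneOn_of_hasDerivWithinAt_nonpos (convex_Iic 0)
      (fun τ _ => ((hsd τ).hasDerivAt.sub (hed b τ)).continuousAt.continuousWithinAt)
      (fun τ _ => ((hsd τ).hasDerivAt.sub (hed b τ)).hasDerivWithinAt)
      (fun τ hτ => sub_nonpos.2 (hup τ (mem_Iic.1 (interior_subset hτ))))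
  have hmono : MonotoneOn (fun τ => s τ - a * Real.exp τ) (Iic 0) :=
    monotoneOn_of_hasDerivWithinAt_nonneg (convex_Iic 0)
      (fun τ _ => ((hsd τ).hasDerivAt.sub (hed a τ)).continuousAt.continuousWithinAt)
      (fun τ _ => ((hsd τ).hasDerivAt.sub (hed a τ)).hasDerivWithinAt)
      (fun τ hτ => sub_nonneg.2 (hlow τ (mem_Iic.1 (interior_subset hτ))))
  have hb : 0 < b := by
    have := (hlow 0 le_rfl).trans (hup 0 le_rfl)
    simp only [Real.exp_zero, mul_one] at this
    linarith
  have hbdd : BddBelow (range s) := by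
    refine ⟨-b, ?_⟩
    rintro _ ⟨τ, rfl⟩
    rcases le_total τ 0 with h | h
    · have := hanti h (mem_Iic.2 le_rfl) h
      simp only [hs0, Real.exp_zero] at this
      nlinarith [Real.exp_pos τ]
    · linarith [hsmono.monotone h]
  have hlim := tendsto_atBot_ciInf hsmono.monotone hbdd
  -- `m` is the limit of `s` as `τ → -∞`, the initial singularity. Time is then `t = s - m`, and `T
  -- = -m` since `s 0 = 0`.
  set m := ⨅ τ, s τ with hm
  have hlt : ∀ τ, m < s τ := fun τ =>
    (ciInf_le hbdd (τ - 1)).trans_lt (hsmono (by linarith))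
  have hexp0 : ∀ c : ℝ, Tendsto (fun τ => s τ - c * Real.exp τ) atBot (𝓝 m) := fun c => by
    simpa using hlim.sub (Real.tendsto_exp_atBot.const_mul c)
  have htup : ∀ τ ≤ 0, s τ - m ≤ b * Real.exp τ := fun τ hτ => by
    have : s τ - b * Real.exp τ ≤ m := ge_of_tendsto (hexp0 b)
      ((eventually_le_atBot τ).mono fun x hx => hanti (hx.trans hτ) hτ hx)
    linarith
  have htlow : ∀ τ ≤ 0, a * Real.exp τ ≤ s τ - m := fun τ hτ => by
    have : m ≤ s τ - a * Real.exp τ := le_of_tendsto (hexp0 a)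
      ((eventually_le_atBot τ).mono fun x hx => hmono (hx.trans hτ) hτ hx)
    linarith
  have hfd : ∀ τ, HasStrictDerivAt (fun τ => s τ - m) (H τ)⁻¹ τ := fun τ => (hsd τ).sub_const m
  have hinj : Function.Injective fun τ => s τ - m := fun x y hxy =>
    hsmono.injective (by simpa using hxy)
  set θ := Function.invFun fun τ => s τ - m with hθ
  have hleft : ∀ τ, θ (s τ - m) = τ := Function.leftInverse_invFun hinj
  have hsurj : ∀ t ∈ Ioc 0 (-m), ∃ τ ≤ 0, s τ - m = t := by
    intro t ht
    obtain ⟨x, hx⟩ := ((hlim.eventually_lt_const (by linarith [ht.1] : m < t + m)).and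
      (eventually_le_atBot 0)).exists
    obtain ⟨τ, hτ, hτ'⟩ := intermediate_value_Icc hx.2
      (fun τ _ => (hsd τ).hasDerivAt.continuousAt.continuousWithinAt : ContinuousOn s (Icc x 0))
      (show t + m ∈ Icc (s x) (s 0) from ⟨hx.1.le, by linarith [ht.2]⟩)
    exact ⟨τ, hτ.2, by linarith⟩
  have hmain : ∀ t ∈ Ioc 0 (-m), θ t ≤ 0 ∧ HasDerivAt θ (H (θ t)) t ∧
      a * Real.exp (θ t) ≤ t ∧ t ≤ b * Real.exp (θ t) := by
    intro t ht
    obtain ⟨τ, hτ, rfl⟩ := hsurj t ht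
    rw [hleft]
    refine ⟨hτ, ?_, htlow τ hτ, htup τ hτ⟩
    simpa using ((hfd τ).to_local_left_inverse (inv_ne_zero (hpos τ).ne')
      (Eventually.of_forall hleft)).hasDerivAt
  have hmpos : 0 < -m := by linarith [hlt 0]
  refine ⟨-m, hmpos, θ, ?_, hmain, ?_⟩
  · simpa [hs0] using hleft 0
  · have h1 : Tendsto (fun t => Real.log (t / a)) (𝓝[>] 0) atBot := by
      refine Real.tendsto_log_nhdsGT_zero.comp (tendsto_nhdsWithin_iff.2 ⟨?_, ?_⟩)
      · have : Tendsto (fun t : ℝ => t / a) (𝓝 0) (𝓝 (0 / a)) := tendsto_id.div_const a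
        rw [zero_div] at this
        exact this.mono_left nhdsWithin_le_nhds
      · filter_upwards [self_mem_nhdsWithin] with t ht
        exact div_pos ht ha
    refine tendsto_atBot_mono' _ ?_ h1
    filter_upwards [Ioc_mem_nhdsGT hmpos] with t ht
    rw [Real.le_log_iff_exp_le (div_pos ht.1 ha), le_div_iff₀ ha]
    linarith [(hmain t ht).2.2.1]

/-! ### Growth of the potential and the asymptotics -/

theorem IsWBI.hasDerivAt {V : ℝ → ℝ} {N : ℝ} (hV : IsWBI V N) (x : ℝ) :
    HasDerivAt V (deriv V x) x :=
  (hV.contDiff.differentiable (by norm_num) x).hasDerivAt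

theorem IsWBI.tendsto_deriv_div {V : ℝ → ℝ} {N : ℝ} (hV : IsWBI V N) :
    Tendsto (fun x => deriv V x / V x) atTop (𝓝 N) := by
  simpa [WV] using hV.tendsto_WV.add_const N

/-- Far out, the values of `V` at points at bounded distance are comparable. -/
theorem IsWBI.exists_le_exp_mul {V : ℝ → ℝ} {N : ℝ} (hV : IsWBI V N) :
    ∃ M ≥ 0, ∃ Φ, ∀ x ≥ Φ, 0 < V x ∧ ∀ y ≥ Φ, V x ≤ Real.exp (M * |x - y|) * V y := by
  obtain ⟨φ₀, -, hpos⟩ := hV.eventually_pos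
  obtain ⟨Φ, hΦ⟩ := eventually_atTop.1
    ((eventually_gt_atTop φ₀).and (hV.tendsto_deriv_div.abs.eventually_lt_const (lt_add_one |N|)))
  have hVpos : ∀ x ≥ Φ, 0 < V x := fun x hx => hpos x (hΦ x hx).1
  refine ⟨|N| + 1, by positivity, Φ, fun x hx => ⟨hVpos x hx, fun y hy => ?_⟩⟩
  -- Beyond `Φ`, `log V` is Lipschitz with constant `|N| + 1`.
  have h := (convex_Ici Φ).norm_image_sub_le_of_norm_hasDerivWithin_le
    (f := fun x => Real.log (V x)) (f' := fun x => deriv V x / V x) (C := |N| + 1)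
    (fun z hz => ((hV.hasDerivAt z).log (hVpos z hz).ne').hasDerivWithinAt)
    (fun z hz => (hΦ z hz).2.le) (mem_Ici.2 hy) (mem_Ici.2 hx)
  rw [Real.norm_eq_abs, Real.norm_eq_abs] at h
  have h1 := (le_abs_self _).trans h
  rw [← Real.log_le_log_iff (hVpos x hx) (mul_pos (Real.exp_pos _) (hVpos y hy)),
    Real.log_mul (Real.exp_pos _).ne' (hVpos y hy).ne', Real.log_exp]
  linarith

theorem tendsto_neg_sqrt_mul_log :
    Tendsto (fun t => -√(2 / 3) * Real.log t) (𝓝[>] 0) atTop :=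
  Real.tendsto_log_nhdsGT_zero.const_mul_atBot_of_neg (neg_lt_zero.2 sqrt_two_thirds_pos)

/-- The crude bounds (`K` comparable to `1/t`, `φ + √(2/3) log t` bounded) bootstrap: they control
the potential terms, and integrating the equations then gives the sharp errors. -/
theorem hasMasslessAsymptotics {V K φ φdot : ℝ → ℝ} {N T a b C : ℝ} (hV : IsWBI V N)
    (hN : N ^ 2 < 6) (hT : 0 < T) (ha : 0 < a)
    (hφd : ∀ t ∈ Ioo 0 T, HasDerivAt φ (φdot t) t)
    (hKd : ∀ t ∈ Ioo 0 T, HasDerivAt K (-(3 / 2) * φdot t ^ 2) t)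
    (hmem : ∀ t ∈ Ioo 0 T, (K t, φ t, φdot t) ∈ physicalSpace V)
    (hneg : ∀ t ∈ Ioo 0 T, φdot t ≤ 0)
    (hKlow : ∀ t ∈ Ioo 0 T, a / t ≤ K t) (hKup : ∀ t ∈ Ioo 0 T, K t ≤ b / t)
    (hφC : ∀ t ∈ Ioo 0 T, |φ t + √(2 / 3) * Real.log t| ≤ C) :
    ∃ c > 0, HasMasslessAsymptotics V K φ φdot c := by
  have hr := sqrt_two_thirds_pos
  have hr2 := sqrt_two_thirds_sq
  set r := √(2 / 3 : ℝ) with hrdef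
  obtain ⟨M, hM, Φ, hΦ⟩ := hV.exists_le_exp_mul
  have hrN : r * N < 2 := by
    by_contra! h
    nlinarith
  obtain ⟨μ, hμ, hμN⟩ : ∃ μ > 0, r * N < 2 - μ := ⟨(2 - r * N) / 2, by linarith, by linarith⟩
  have hlog : Tendsto (fun t => -r * Real.log t) (𝓝[>] 0) atTop := tendsto_neg_sqrt_mul_log
  -- The margin `C` ensures that `φ t` itself lies beyond `Φ`.
  have hev : ∀ᶠ t in 𝓝[>] (0 : ℝ), t ∈ Ioo 0 T ∧ Φ + C ≤ -r * Real.log t ∧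
      Φ ≤ -r * Real.log t ∧
      r * (deriv V (-r * Real.log t) / V (-r * Real.log t)) < 2 - μ :=
    (show ∀ᶠ t in 𝓝[>] (0 : ℝ), t ∈ Ioo 0 T from Ioo_mem_nhdsGT hT).and ((hlog.eventually_ge_atTop _).and ((hlog.eventually_ge_atTop _).and
      (hlog.eventually ((hV.tendsto_deriv_div.const_mul r).eventually_lt_const hμN))))
  obtain ⟨β, hβ, hβsub⟩ := mem_nhdsGT_iff_exists_Ioo_subset.1 hev
  replace hβ : 0 < β := hβ
  have hT' : ∀ t ∈ Ioo 0 β, t ∈ Ioo 0 T := fun t ht => (hβsub ht).1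
  set v : ℝ → ℝ := fun t => V (-r * Real.log t) with hv
  have hvpos : ∀ t ∈ Ioo 0 β, 0 < v t := fun t ht => (hΦ _ (hβsub ht).2.2.1).1
  set D := Real.exp (M * C) with hD
  have hDpos : 0 < D := Real.exp_pos _
  have hVD : ∀ t ∈ Ioo 0 β, V (φ t) ≤ D * v t := by
    intro t ht
    obtain ⟨h1, h2, h3, -⟩ := hβsub ht
    have h4 := hφC t h1
    have h5 : φ t ≥ Φ := by linarith [(abs_le.1 h4).1]
    refine ((hΦ _ h5).2 _ h3).trans (mul_le_mul_of_nonneg_right ?_ (hvpos t ht).le)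
    rw [hD, Real.exp_le_exp, show φ t - -r * Real.log t = φ t + r * Real.log t by ring]
    exact mul_le_mul_of_nonneg_left h4 hM
  have hvd : ∀ t ∈ Ioo 0 β, HasDerivAt v (deriv V (-r * Real.log t) * (-r * t⁻¹)) t :=
    fun t ht => (hV.hasDerivAt _).comp t ((Real.hasDerivAt_log ht.1.ne').const_mul (-r))
  have hvd' : ∀ t ∈ Ioo 0 β, r * deriv V (-r * Real.log t) ≤ (2 - μ) * v t := by
    intro t ht
    have h := (hβsub ht).2.2.2.le
    rwa [← mul_div_assoc, div_le_iff₀ (hvpos t ht)] at h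
  -- the derivatives of `t² v` and `t³ v` dominate `t v` and `t² v`
  have hg2 : ∀ t ∈ Ioo 0 β, HasDerivAt (fun t => t ^ 2 * v t)
      (t * (2 * v t - r * deriv V (-r * Real.log t))) t := fun t ht => by
    refine ((hasDerivAt_pow 2 t).mul (hvd t ht)).congr_deriv ?_
    have := ht.1.ne'
    field_simp
    push_cast
    ring
  have hg3 : ∀ t ∈ Ioo 0 β, HasDerivAt (fun t => t ^ 3 * v t)
      (t ^ 2 * (3 * v t - r * deriv V (-r * Real.log t))) t := fun t ht => by
    refine ((hasDerivAt_pow 3 t).mul (hvd t ht)).congr_deriv ?_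
    have := ht.1.ne'
    field_simp
    push_cast
    ring
  have hg2' : ∀ t ∈ Ioo 0 β, μ * (t * v t) ≤ t * (2 * v t - r * deriv V (-r * Real.log t)) :=
    fun t ht => by nlinarith [hvd' t ht, ht.1]
  have hg3' : ∀ t ∈ Ioo 0 β, t ^ 2 * v t ≤ t ^ 2 * (3 * v t - r * deriv V (-r * Real.log t)) :=
    fun t ht => mul_le_mul_of_nonneg_left
      (by nlinarith [hvd' t ht, mul_pos hμ (hvpos t ht)]) (sq_nonneg t)
  have hKpos : ∀ t ∈ Ioo 0 β, 0 < K t := fun t ht => (hmem t (hT' t ht)).1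
  have hcon : ∀ t ∈ Ioo 0 β, K t ^ 2 = 3 * V (φ t) + 3 / 2 * φdot t ^ 2 :=
    fun t ht => (hmem t (hT' t ht)).2
  have hKinv : ∀ t ∈ Ioo 0 β, (K t)⁻¹ ≤ t / a := fun t ht => by
    rw [← inv_div]
    exact inv_anti₀ (div_pos ha ht.1) (hKlow t (hT' t ht))
  -- the Hubble parameter
  obtain ⟨l, hl⟩ := exists_abs_sub_le_of_abs_deriv_le (h := fun t => (K t)⁻¹ - t)
    (h' := fun t => -(3 * V (φ t)) * (K t)⁻¹ ^ 2) (C := 3 * D / a ^ 2) (by positivity) hβ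
    (fun t ht => by
      refine (((hKd t (hT' t ht)).inv (hKpos t ht).ne').sub (hasDerivAt_id t)).congr_deriv ?_
      have := (hKpos t ht).ne'
      field_simp
      linear_combination (-2) * hcon t ht)
    hg3 (fun t ht => mul_nonneg (pow_nonneg ht.1.le 3) (hvpos t ht).le)
    (fun t ht => by
      have h1 := hV.nonneg (φ t)
      rw [abs_mul, abs_neg, abs_of_nonneg (by positivity), abs_of_nonneg (by positivity)]
      have h2 : (K t)⁻¹ ^ 2 ≤ (t / a) ^ 2 :=
        pow_le_pow_left₀ (inv_nonneg.2 (hKpos t ht).le) (hKinv t ht) 2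
      calc 3 * V (φ t) * (K t)⁻¹ ^ 2 ≤ 3 * (D * v t) * (t / a) ^ 2 :=
            mul_le_mul (by linarith [hVD t ht]) h2 (by positivity)
              (by have := hvpos t ht; positivity)
        _ = 3 * D / a ^ 2 * (t ^ 2 * v t) := by ring
        _ ≤ _ := mul_le_mul_of_nonneg_left (hg3' t ht) (by positivity))
  have hg2mono : MonotoneOn (fun t => t ^ 2 * v t) (Ioo 0 β) :=
    monotoneOn_of_hasDerivWithinAt_nonneg (convex_Ioo 0 β)
      (fun t ht => (hg2 t ht).continuousAt.continuousWithinAt)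
      (fun t ht => (hg2 t (interior_subset ht)).hasDerivWithinAt)
      (fun t ht => by
        have ht' := interior_subset ht
        exact (mul_nonneg hμ.le (mul_nonneg ht'.1.le (hvpos t ht').le)).trans (hg2' t ht'))
  -- `t² v` is increasing, hence bounded near `0`; the extra factor `t` gives the limit, which
  -- forces `l = 0`.
  have hg3lim : Tendsto (fun t => t ^ 3 * v t) (𝓝[>] 0) (𝓝 0) := by
    have hβ2 : β / 2 ∈ Ioo 0 β := ⟨by linarith, by linarith⟩
    have h1 : Tendsto (fun t => t * ((β / 2) ^ 2 * v (β / 2))) (𝓝[>] 0) (𝓝 0) := by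
      have h2 := (tendsto_id (α := ℝ) (x := 𝓝 0)).mul_const ((β / 2) ^ 2 * v (β / 2))
      rw [zero_mul] at h2
      exact h2.mono_left nhdsWithin_le_nhds
    refine squeeze_zero' ?_ ?_ h1
    · filter_upwards [Ioo_mem_nhdsGT hβ] with t ht
      exact mul_nonneg (pow_nonneg ht.1.le 3) (hvpos t ht).le
    · filter_upwards [Ioo_mem_nhdsGT hβ2.1] with t ht
      have := hg2mono ⟨ht.1, ht.2.trans hβ2.2⟩ hβ2 ht.2.le
      rw [show t ^ 3 * v t = t * (t ^ 2 * v t) by ring]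
      exact mul_le_mul_of_nonneg_left this ht.1.le
  have hid : Tendsto (fun t : ℝ => t) (𝓝[>] 0) (𝓝 0) := tendsto_id.mono_left nhdsWithin_le_nhds
  have hKlim : Tendsto (fun t => (K t)⁻¹ - t) (𝓝[>] 0) (𝓝 0) := by
    have h1 : Tendsto (fun t => (K t)⁻¹) (𝓝[>] 0) (𝓝 0) := by
      refine squeeze_zero' (g := fun t => t / a) ?_ ?_ (by simpa using hid.div_const a)
      · filter_upwards [Ioo_mem_nhdsGT hβ] with t ht using inv_nonneg.2 (hKpos t ht).le
      · filter_upwards [Ioo_mem_nhdsGT hβ] with t ht using hKinv t ht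
    simpa using h1.sub hid
  have hl0 : l = 0 := by
    have h1 : Tendsto (fun t => |((K t)⁻¹ - t) - l|) (𝓝[>] 0) (𝓝 0) := by
      refine squeeze_zero' (Eventually.of_forall fun t => abs_nonneg _)
        ((Ioo_mem_nhdsGT hβ : Ioo 0 β ∈ 𝓝[>] 0) |> mem_of_superset <| hl) ?_
      simpa using hg3lim.const_mul (3 * D / a ^ 2)
    have h2 := tendsto_nhds_unique h1 (hKlim.sub_const l).abs
    simpa [eq_comm] using h2
  set C₁ := 3 * D / a ^ 2 * b with hC₁
  have hK : ∀ t ∈ Ioo 0 β, |K t - t⁻¹| ≤ C₁ * (t * v t) := by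
    intro t ht
    have h1 := hl t ht
    rw [hl0, sub_zero] at h1
    have htpos := ht.1
    have hKt := hKpos t ht
    have hvt := hvpos t ht
    rw [show K t - t⁻¹ = -((K t)⁻¹ - t) * (K t * t⁻¹) by field_simp; ring, abs_mul, abs_neg,
      abs_of_pos (mul_pos hKt (inv_pos.2 htpos))]
    calc |(K t)⁻¹ - t| * (K t * t⁻¹)
        ≤ 3 * D / a ^ 2 * (t ^ 3 * v t) * (b / t * t⁻¹) :=
          mul_le_mul h1 (mul_le_mul_of_nonneg_right (hKup t (hT' t ht)) (by positivity))
            (by positivity) (by positivity)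
      _ = C₁ * (t * v t) := by rw [hC₁]; field_simp
  -- the velocity of the scalar field
  set C₂ := 2 * D / (r * a) + r * C₁ with hC₂
  have hφdot : ∀ t ∈ Ioo 0 β, |φdot t - -r * t⁻¹| ≤ C₂ * (t * v t) := by
    intro t ht
    have htpos := ht.1
    have hKt := hKpos t ht
    have hvt := hvpos t ht
    have hVt := hV.nonneg (φ t)
    have hnt := hneg t (hT' t ht)
    have hrK := mul_pos hr hKt
    -- The constraint, factored. As `φ̇ ≤ 0`, the second factor is at least `r K`, so the first is
    -- `O(V/K) = O(t v)`.
    have hprod : (r * K t + φdot t) * (r * K t - φdot t) = 2 * V (φ t) := by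
      linear_combination (K t) ^ 2 * hr2 + 2 / 3 * hcon t ht
    have hden : 0 < r * K t - φdot t := by linarith
    have h1 : 0 ≤ r * K t + φdot t := by
      by_contra! h
      nlinarith [mul_neg_of_neg_of_pos h hden]
    have h2 : r * K t + φdot t ≤ 2 * D / (r * a) * (t * v t) := by
      have h3 : (r * K t + φdot t) * (r * K t) ≤ 2 * V (φ t) := by nlinarith
      calc r * K t + φdot t ≤ 2 * V (φ t) / (r * K t) := (le_div_iff₀ hrK).2 h3
        _ = 2 * V (φ t) / r * (K t)⁻¹ := by field_simp
        _ ≤ 2 * (D * v t) / r * (t / a) := by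
          have := hVD t ht
          exact mul_le_mul (by gcongr) (hKinv t ht) (by positivity) (by positivity)
        _ = _ := by field_simp
    have h4 := abs_mul r (K t - t⁻¹)
    rw [abs_of_pos hr] at h4
    calc |φdot t - -r * t⁻¹| = |(r * K t + φdot t) - r * (K t - t⁻¹)| := by congr 1; ring
      _ ≤ |r * K t + φdot t| + |r * (K t - t⁻¹)| := abs_sub _ _
      _ ≤ 2 * D / (r * a) * (t * v t) + r * (C₁ * (t * v t)) := by
        rw [abs_of_nonneg h1, h4]
        exact add_le_add h2 (mul_le_mul_of_nonneg_left (hK t ht) hr.le)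
      _ = C₂ * (t * v t) := by rw [hC₂]; ring
  have hC₂pos : 0 ≤ C₂ := by
    have hβ2 : β / 2 ∈ Ioo 0 β := ⟨by linarith, by linarith⟩
    exact nonneg_of_mul_nonneg_left ((abs_nonneg _).trans (hφdot _ hβ2))
      (mul_pos hβ2.1 (hvpos _ hβ2))
  -- the scalar field
  obtain ⟨m, hm⟩ := exists_abs_sub_le_of_abs_deriv_le (h := fun t => φ t + r * Real.log t)
    (h' := fun t => φdot t - -r * t⁻¹) (C := C₂ / μ) (by positivity) hβ
    (fun t ht => ((hφd t (hT' t ht)).add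
      ((Real.hasDerivAt_log ht.1.ne').const_mul r)).congr_deriv (by ring))
    hg2 (fun t ht => mul_nonneg (sq_nonneg t) (hvpos t ht).le)
    (fun t ht => by
      refine (hφdot t ht).trans ?_
      rw [div_mul_eq_mul_div, le_div_iff₀ hμ, mul_assoc]
      exact mul_le_mul_of_nonneg_left (by linarith [hg2' t ht]) hC₂pos)
  have heps : ∀ t, epsV V t = t * v t := fun t => rfl
  have hnorm : ∀ t ∈ Ioo 0 β, ‖epsV V t‖ = t * v t := fun t ht => by
    rw [heps, Real.norm_of_nonneg (mul_nonneg ht.1.le (hvpos t ht).le)]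
  -- `m` is the limiting constant of `φ + r log t`, so `r log c = m`.
  refine ⟨Real.exp (m / r), Real.exp_pos _, ?_, ?_, ?_⟩
  · refine IsBigO.of_bound C₁ ?_
    filter_upwards [Ioo_mem_nhdsGT hβ] with t ht
    rw [hnorm t ht]
    exact hK t ht
  · refine IsBigO.of_bound (C₂ / μ) ?_
    filter_upwards [Ioo_mem_nhdsGT hβ] with t ht
    rw [norm_mul, hnorm t ht, Real.norm_of_nonneg ht.1.le,
      Real.log_div ht.1.ne' (Real.exp_pos _).ne', Real.log_exp]
    convert hm t ht using 1
    · rw [Real.norm_eq_abs]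
      congr 1
      field_simp
      ring
    · ring
  · refine IsBigO.of_bound C₂ ?_
    filter_upwards [Ioo_mem_nhdsGT hβ] with t ht
    rw [hnorm t ht]
    exact hφdot t ht

/-! ### Uniqueness and inextendibility for the field equations -/

/-- The right-hand side of the field equations for `(K, φ, φ̇)`. -/
noncomputable def physicalField (V : ℝ → ℝ) (q : ℝ × ℝ × ℝ) : ℝ × ℝ × ℝ :=
  (-(3 / 2) * q.2.2 ^ 2, q.2.2, -q.1 * q.2.2 - deriv V q.2.1)

theorem contDiff_physicalField {V : ℝ → ℝ} (hV : ContDiff ℝ 2 V) :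
    ContDiff ℝ 1 (physicalField V) := by
  have h : ContDiff ℝ 1 (deriv V) := ((contDiff_succ_iff_deriv (n := 1)).1 hV).2.2
  unfold physicalField
  fun_prop

variable {V K φ φdot K₁ φ₁ φdot₁ : ℝ → ℝ} {I : Set ℝ}

theorem IsSolution.hasDerivWithinAt (h : IsSolution V I K φ φdot) {t : ℝ} (ht : t ∈ I) :
    HasDerivWithinAt (fun t => (K t, φ t, φdot t)) (physicalField V (K t, φ t, φdot t)) I t :=
  (h.deriv_K t ht).prodMk ((h.deriv_φ t ht).prodMk (h.deriv_φdot t ht))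

theorem IsSolution.mono {J : Set ℝ} (h : IsSolution V I K φ φdot) (hJ : J ⊆ I) :
    IsSolution V J K φ φdot where
  mem t ht := h.mem t (hJ ht)
  deriv_φ t ht := (h.deriv_φ t (hJ ht)).mono hJ
  deriv_φdot t ht := (h.deriv_φdot t (hJ ht)).mono hJ
  deriv_K t ht := (h.deriv_K t (hJ ht)).mono hJ

theorem IsSolution.comp_add_const (h : IsSolution V I K φ φdot) (c : ℝ) :
    IsSolution V ((· + c) ⁻¹' I) (fun t => K (t + c)) (fun t => φ (t + c))
      (fun t => φdot (t + c)) := by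
  have key : ∀ (g : ℝ → ℝ) (g' t : ℝ), HasDerivWithinAt g g' I (t + c) →
      HasDerivWithinAt (fun t => g (t + c)) g' ((· + c) ⁻¹' I) t := fun g g' t hg => by
    simpa [Function.comp_def] using hg.comp t
      (((hasDerivAt_id t).add_const c).hasDerivWithinAt (s := (· + c) ⁻¹' I)) fun x hx => hx
  exact
    { mem := fun t ht => h.mem _ ht
      deriv_φ := fun t ht => key _ _ _ (h.deriv_φ _ ht)
      deriv_φdot := fun t ht => key _ _ _ (h.deriv_φdot _ ht)
      deriv_K := fun t ht => key _ _ _ (h.deriv_K _ ht) }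

/-- On a compact interval both curves lie in a common closed ball, where the `C¹` field is
Lipschitz. -/
theorem IsSolution.eqOn_Icc (hV : ContDiff ℝ 2 V) {a b : ℝ}
    (h : IsSolution V (Icc a b) K φ φdot) (h₁ : IsSolution V (Icc a b) K₁ φ₁ φdot₁)
    (hb : (K₁ b, φ₁ b, φdot₁ b) = (K b, φ b, φdot b)) :
    EqOn (fun t => (K₁ t, φ₁ t, φdot₁ t)) (fun t => (K t, φ t, φdot t)) (Icc a b) := by
  have hc := fun t (ht : t ∈ Icc a b) => (h.hasDerivWithinAt ht).continuousWithinAt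
  have hc₁ := fun t (ht : t ∈ Icc a b) => (h₁.hasDerivWithinAt ht).continuousWithinAt
  obtain ⟨R, hR⟩ := ((isCompact_Icc.image_of_continuousOn hc).union
    (isCompact_Icc.image_of_continuousOn hc₁)).isBounded.subset_closedBall 0
  obtain ⟨L, hL⟩ := (contDiff_physicalField hV).contDiffOn.exists_lipschitzOnWith one_ne_zero
    (convex_closedBall 0 R) (isCompact_closedBall 0 R)
  have hnhds : ∀ t ∈ Ioc a b, Icc a b ∈ 𝓝[≤] t := fun t ht =>
    mem_of_superset (Icc_mem_nhdsLE ht.1) (Icc_subset_Icc_right ht.2)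
  refine ODE_solution_unique_of_mem_Icc_left (v := fun _ => physicalField V)
    (s := fun _ => Metric.closedBall 0 R) (fun _ _ => hL) hc₁ (fun t ht => ?_) (fun t ht => ?_)
    hc (fun t ht => ?_) (fun t ht => ?_) hb
  · exact (h₁.hasDerivWithinAt (Ioc_subset_Icc_self ht)).mono_of_mem_nhdsWithin (hnhds t ht)
  · exact hR (Or.inr (mem_image_of_mem _ (Ioc_subset_Icc_self ht)))
  · exact (h.hasDerivWithinAt (Ioc_subset_Icc_self ht)).mono_of_mem_nhdsWithin (hnhds t ht)
  · exact hR (Or.inl (mem_image_of_mem _ (Ioc_subset_Icc_self ht)))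

/-- A solution whose Hubble parameter blows up in the past is the only one through its final state,
and cannot be continued. -/
theorem IsSolution.unique_of_tendsto_atTop (hV : ContDiff ℝ 2 V) {s T T' : ℝ}
    (h : IsSolution V (Ioc 0 T) K φ φdot) (hT : 0 < T) (hK : Tendsto K (𝓝[>] 0) atTop)
    (h₁ : IsSolution V (Ioc s T') K₁ φ₁ φdot₁)
    (hT' : (K₁ T', φ₁ T', φdot₁ T') = (K T, φ T, φdot T)) :
    T' - T ≤ s ∧ ∀ t ∈ Ioc s T', (K₁ t, φ₁ t, φdot₁ t) =
      (K (t - T' + T), φ (t - T' + T), φdot (t - T' + T)) := by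
  have key : ∀ t ∈ Ioc s T', T' - T < t → (K₁ t, φ₁ t, φdot₁ t) =
      (K (t - T' + T), φ (t - T' + T), φdot (t - T' + T)) := by
    intro t ht htT
    have hshift := (h.comp_add_const (T - T')).mono (J := Icc t T') fun x hx =>
      ⟨by linarith [hx.1], by linarith [hx.2]⟩
    have := hshift.eqOn_Icc hV
      (h₁.mono fun x hx => ⟨ht.1.trans_le hx.1, hx.2⟩) (by simpa using hT') ⟨le_rfl, ht.2⟩
    simpa only [show t - T' + T = t + (T - T') by ring] using this
  have hle : T' - T ≤ s := by
    -- Otherwise `K₁` would be continuous at `T' - T`, yet just after it agrees with the translate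
    -- of `K`, which blows up there.
    by_contra! hlt
    have hmem : T' - T ∈ Ioc s T' := ⟨hlt, by linarith⟩
    have h1 : Tendsto K₁ (𝓝[>] (T' - T)) (𝓝 (K₁ (T' - T))) :=
      ((h₁.deriv_K _ hmem).continuousWithinAt.mono_of_mem_nhdsWithin
        (mem_of_superset (Ioc_mem_nhdsGT (by linarith : T' - T < T'))
          (Ioc_subset_Ioc_left hlt.le))).tendsto
    have h2 : Tendsto (fun t => t - T' + T) (𝓝[>] (T' - T)) (𝓝[>] 0) := by
      refine tendsto_nhdsWithin_iff.2 ⟨?_, ?_⟩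
      · have : Tendsto (fun t => t - T' + T) (𝓝 (T' - T)) (𝓝 (T' - T - T' + T)) :=
          Continuous.tendsto (by fun_prop) _
        rw [show T' - T - T' + T = 0 by ring] at this
        exact this.mono_left nhdsWithin_le_nhds
      · filter_upwards [self_mem_nhdsWithin] with t ht
        have : T' - T < t := ht
        exact mem_Ioi.2 (by linarith)
    refine not_tendsto_nhds_of_tendsto_atTop ((hK.comp h2).congr' ?_) _ h1
    filter_upwards [Ioc_mem_nhdsGT (by linarith : T' - T < T')] with t ht
    exact (congrArg Prod.fst (key t ⟨hlt.trans ht.1, ht.2⟩ ht.1)).symm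
  exact ⟨hle, fun t ht => key t ht (hle.trans_lt ht.1)⟩

/-! ### From the orbit back to the physical solution -/

/-- The solution is `K = H`, `φ = Φ` and `φ̇ = √(2/3) H y`, all evaluated at `τ = θ t`. As `H⁻¹` and
`t` are both comparable to `exp τ`, the crude bounds needed for the asymptotics follow. -/
theorem IsPastOrbit.exists_isSolution {f : ℝ → ℝ} {N φ₀ ε κ δ : ℝ} {γ : ℝ → ℝ × ℝ} {k : ℕ}
    (h : IsPastOrbit V N f φ₀ δ γ) (hbox : IsRepellingBox V N f φ₀ ε κ δ) (hk : k ≠ 0)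
    (hV : IsWBI V N) (hN : N ^ 2 < 6) (hf : IsCoordinate k V N f φ₀) (hφε : φ₀ ≤ ε⁻¹)
    {q : ℝ × ℝ × ℝ} (hq : q ∈ physicalNear V ε) (hqγ : toYZ f q = γ 0) :
    ∃ T > 0, ∃ K φ φdot θ : ℝ → ℝ, IsSolution V (Ioc 0 T) K φ φdot ∧
      (K T, φ T, φdot T) = q ∧ Tendsto K (𝓝[>] 0) atTop ∧
      θ T = 0 ∧ (∀ t ∈ Ioc 0 T, HasDerivWithinAt θ (K t) (Ioc 0 T) t) ∧
      Tendsto θ (𝓝[>] 0) atBot ∧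
      (∀ t ∈ Ioc 0 T, (K t, φ t, φdot t) ∈ physicalNear V ε ∧
        toYZ f (K t, φ t, φdot t) = γ (θ t)) ∧
      ∃ c > 0, HasMasslessAsymptotics V K φ φdot c := by
  obtain ⟨Kq, φq, ψq⟩ := q
  obtain ⟨⟨hKq, hcon⟩, hφq⟩ := hq
  simp only at hKq hcon hφq
  have hr := sqrt_two_thirds_pos
  have hr2 := sqrt_two_thirds_sq
  have hy0 : (γ 0).1 = √(3 / 2) * ψq / Kq := by rw [← hqγ, toYZ]
  have hz0 : f φq = (γ 0).2 := by rw [← hqγ, toYZ]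
  rw [sqrt_three_halves] at hy0
  obtain ⟨Φ, hΦ0, hΦd, hΦge, hΦf, C, hC⟩ :=
    h.exists_scalar hbox hk hf hφε (hφε.trans_lt hφq) hz0
  obtain ⟨H, hH0, hHpos, hHd, a, ha, b, hb, hHab⟩ := h.exists_hubble hbox hKq
  have hHcont : Continuous H := continuous_iff_continuousAt.2 fun τ => (hHd τ).continuousAt
  obtain ⟨T, hT, θ, hθT, hθ, hθlim⟩ := exists_time ha hHcont hHpos
    (fun τ hτ => (hHab τ hτ).1) (fun τ hτ => (hHab τ hτ).2)
  set r := √(2 / 3 : ℝ) with hrdef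
  have hcon0 : H 0 ^ 2 * (1 - (γ 0).1 ^ 2) = 3 * V (Φ 0) := by
    rw [hH0, hΦ0, hy0]
    field_simp
    linear_combination 4 * hcon - 9 * ψq ^ 2 * hr2
  have hφ₀ : ∀ τ ≤ 0, φ₀ ≤ Φ τ := fun τ hτ => hφε.trans (hφq.le.trans (hΦge τ hτ))
  have hconτ := fun τ (hτ : τ ≤ 0) => h.constraint hf hV hΦd hφ₀ hΦf hHd hcon0 hτ
  have hKd : ∀ t ∈ Ioc 0 T, HasDerivAt (fun t => H (θ t))
      (-(3 / 2) * (r * H (θ t) * (γ (θ t)).1) ^ 2) t := fun t ht =>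
    ((hHd (θ t)).comp t (hθ t ht).2.1).congr_deriv
      (by linear_combination (3 / 2) * (H (θ t)) ^ 2 * (γ (θ t)).1 ^ 2 * hr2)
  have hφd : ∀ t ∈ Ioc 0 T, HasDerivAt (fun t => Φ (θ t)) (r * H (θ t) * (γ (θ t)).1) t :=
    fun t ht => ((hΦd (θ t)).comp t (hθ t ht).2.1).congr_deriv (by ring)
  have hψd : ∀ t ∈ Ioc 0 T, HasDerivAt (fun t => r * H (θ t) * (γ (θ t)).1)
      (-H (θ t) * (r * H (θ t) * (γ (θ t)).1) - deriv V (Φ (θ t))) t := by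
    intro t ht
    have hτ := (hθ t ht).1
    have hVne := (hf.V_pos _ (hφ₀ _ hτ)).ne'
    refine ((((hHd (θ t)).const_mul r).mul (h.hasDerivAt_fst hτ)).comp t
      (hθ t ht).2.1).congr_deriv ?_
    simp only [field, ← hΦf _ hτ, hf.Wbar_add (hφ₀ _ hτ), one_div_sqrt_six]
    have hc := hconτ _ hτ
    field_simp
    linear_combination (-r ^ 2 * deriv V (Φ (θ t))) * hc -
      3 * V (Φ (θ t)) * deriv V (Φ (θ t)) * hr2
  have hphys : ∀ t ∈ Ioc 0 T,
      (H (θ t), Φ (θ t), r * H (θ t) * (γ (θ t)).1) ∈ physicalSpace V := fun t ht =>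
    ⟨hHpos _, by
      linear_combination hconτ _ (hθ t ht).1 - 3 / 2 * (H (θ t)) ^ 2 * (γ (θ t)).1 ^ 2 * hr2⟩
  have hKlow : ∀ t ∈ Ioc 0 T, a / b / t ≤ H (θ t) := fun t ht => by
    obtain ⟨h1, -, h2, h3⟩ := hθ t ht
    have h4 := (hHab _ h1).2
    rw [inv_le_comm₀ (hHpos _) (by positivity)] at h4
    refine le_trans ?_ h4
    rw [div_div, div_le_iff₀ (mul_pos hb ht.1), ← div_eq_inv_mul, le_div_iff₀ (by positivity)]
    nlinarith
  have hKup : ∀ t ∈ Ioc 0 T, H (θ t) ≤ b / a / t := fun t ht => by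
    obtain ⟨h1, -, h2, h3⟩ := hθ t ht
    have h4 := (hHab _ h1).1
    rw [le_inv_comm₀ (by positivity) (hHpos _)] at h4
    refine h4.trans ?_
    rw [div_div, le_div_iff₀ (mul_pos ha ht.1), inv_mul_le_iff₀ (by positivity)]
    nlinarith
  have hφC : ∀ t ∈ Ioc 0 T,
      |Φ (θ t) + r * Real.log t| ≤ C + r * (|Real.log a| + |Real.log b|) := fun t ht => by
    obtain ⟨h1, -, h2, h3⟩ := hθ t ht
    have h4 := Real.log_le_log (by positivity) h2
    have h5 := Real.log_le_log ht.1 h3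
    rw [Real.log_mul ha.ne' (Real.exp_pos _).ne', Real.log_exp] at h4
    rw [Real.log_mul hb.ne' (Real.exp_pos _).ne', Real.log_exp] at h5
    have h6 : |Real.log t - θ t| ≤ |Real.log a| + |Real.log b| := abs_le.2
      ⟨by linarith [neg_abs_le (Real.log a), abs_nonneg (Real.log b)],
        by linarith [le_abs_self (Real.log b), abs_nonneg (Real.log a)]⟩
    calc |Φ (θ t) + r * Real.log t| = |(Φ (θ t) + r * θ t) + r * (Real.log t - θ t)| := by
          congr 1; ring
      _ ≤ |Φ (θ t) + r * θ t| + r * |Real.log t - θ t| := by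
          rw [← abs_of_pos hr, ← abs_mul, abs_of_pos hr]
          exact abs_add_le _ _
      _ ≤ _ := add_le_add (hC _ h1) (mul_le_mul_of_nonneg_left h6 hr.le)
  refine ⟨T, hT, fun t => H (θ t), fun t => Φ (θ t), fun t => r * H (θ t) * (γ (θ t)).1, θ,
    ⟨hphys, fun t ht => (hφd t ht).hasDerivWithinAt, fun t ht => (hψd t ht).hasDerivWithinAt,
      fun t ht => (hKd t ht).hasDerivWithinAt⟩, ?_, ?_, hθT,
    fun t ht => (hθ t ht).2.1.hasDerivWithinAt, hθlim, fun t ht => ⟨⟨hphys t ht, ?_⟩, ?_⟩, ?_⟩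
  · simp only [hθT, hH0, hΦ0, hy0, Prod.mk.injEq, true_and]
    field_simp
    linear_combination 3 * ψq * hr2
  · have h1 : Tendsto (fun t : ℝ => a / b / t) (𝓝[>] 0) atTop := by
      simpa only [div_eq_mul_inv (a / b)] using
        tendsto_inv_nhdsGT_zero.const_mul_atTop (div_pos ha hb)
    refine tendsto_atTop_mono' _ ?_ h1
    filter_upwards [Ioc_mem_nhdsGT hT] with t ht using hKlow t ht
  · exact hφq.trans_le (hΦge _ (hθ t ht).1)
  · rw [toYZ, sqrt_three_halves]
    refine Prod.ext ?_ (hΦf _ (hθ t ht).1)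
    have := (hHpos (θ t)).ne'
    simp only
    field_simp
    linear_combination 3 * (γ (θ t)).1 * hr2
  · have hsub : ∀ t ∈ Ioo 0 T, t ∈ Ioc 0 T := fun t ht => Ioo_subset_Ioc_self ht
    exact hasMasslessAsymptotics hV hN hT (div_pos ha hb) (fun t ht => hφd t (hsub t ht))
      (fun t ht => hKd t (hsub t ht)) (fun t ht => hphys t (hsub t ht))
      (fun t ht => mul_nonpos_of_nonneg_of_nonpos (mul_nonneg hr.le (hHpos _).le)
        (by linarith [(h.fst_mem _ (hθ t (hsub t ht)).1).2, hbox.δ_le]))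
      (fun t ht => hKlow t (hsub t ht)) (fun t ht => hKup t (hsub t ht))
      (fun t ht => hφC t (hsub t ht))

end FRW

theorem mainTheorem3 (V : ℝ → ℝ) (N : ℝ) (hV : FRW.IsClassWBI 2 V N) (hN : N ^ 2 < 6)
    (f : ℝ → ℝ) (φ₀ : ℝ) (hf : FRW.IsCoordinate 2 V N f φ₀) (ε : ℝ) (hε : 0 < ε)
    (hφε : φ₀ ≤ ε⁻¹) :
    ∃ U ∈ 𝓝 FRW.pMinus, ∀ p ∈ U ∩ FRW.closedRegion f ε,
      ∃ γ : ℝ → ℝ × ℝ,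
        -- `γ` is the past trajectory of `p`, and it tends to `p₋` in the past
        FRW.IsTrajectory V N f φ₀ ε (Iic 0) γ ∧ γ 0 = p ∧
        (∀ S ≥ 0, ∀ χ : ℝ → ℝ × ℝ, FRW.IsTrajectory V N f φ₀ ε (Icc (-S) 0) χ → χ 0 = p →
          EqOn χ γ (Icc (-S) 0)) ∧
        Tendsto γ atBot (𝓝 FRW.pMinus) ∧
        -- the physical solution through `p`, when `p` represents a physical state `q`
        ∀ q ∈ FRW.physicalNear V ε, FRW.toYZ f q = p →
          ∃ T > 0, ∃ K φ φdot : ℝ → ℝ,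
            FRW.IsSolution V (Ioc 0 T) K φ φdot ∧ (K T, φ T, φdot T) = q ∧
            -- it is the only one, and it cannot be continued further into the past
            (∀ s T' : ℝ, s < T' → ∀ K₁ φ₁ φdot₁ : ℝ → ℝ,
              FRW.IsSolution V (Ioc s T') K₁ φ₁ φdot₁ → (K₁ T', φ₁ T', φdot₁ T') = q →
              T' - T ≤ s ∧ ∀ t ∈ Ioc s T', (K₁ t, φ₁ t, φdot₁ t) =
                (K (t - T' + T), φ (t - T' + T), φdot (t - T' + T))) ∧
            -- with the time `τ`, where `dτ/dt = K`, it is the trajectory `γ`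
            (∃ τ : ℝ → ℝ, τ T = 0 ∧
              (∀ t ∈ Ioc 0 T, HasDerivWithinAt τ (K t) (Ioc 0 T) t) ∧
              Tendsto τ (𝓝[>] 0) atBot ∧
              ∀ t ∈ Ioc 0 T, (K t, φ t, φdot t) ∈ FRW.physicalNear V ε ∧
                FRW.toYZ f (K t, φ t, φdot t) = γ (τ t)) ∧
            ∃ c > 0, FRW.HasMasslessAsymptotics V K φ φdot c := by
  obtain ⟨κ, δ, hbox⟩ := FRW.exists_isRepellingBox hV.isWBI hf hN hφε
  have hδ := hbox.δ_pos
  refine ⟨Iio (-1 + δ) ×ˢ Iio δ,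
    prod_mem_nhds (Iio_mem_nhds (by linarith)) (Iio_mem_nhds hδ), ?_⟩
  rintro p ⟨⟨hp1, hp2⟩, hp3, hp4⟩
  obtain ⟨γ, hγ0, hγ⟩ := FRW.exists_isPastOrbit two_ne_zero hf hφε hbox
    ⟨hp3.1, (mem_Iio.1 hp1).le⟩ ⟨hp4.1, (mem_Iio.1 hp2).le⟩
  have htraj := hγ.isTrajectory hbox
  refine ⟨γ, htraj, hγ0, fun S _ χ hχ hχ0 =>
    htraj.eqOn two_ne_zero hf hφε hχ (hχ0.trans hγ0.symm),
    hγ.tendsto hbox two_ne_zero hf hφε, fun q hq hqp => ?_⟩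
  obtain ⟨T, hT, K, φ, φdot, θ, hsol, hend, hK, hθT, hθ, hθlim, hnear, hasymp⟩ :=
    hγ.exists_isSolution hbox two_ne_zero hV.isWBI hN hf hφε hq (hqp.trans hγ0.symm)
  exact ⟨T, hT, K, φ, φdot, hsol, hend,
    fun s T' _ K₁ φ₁ φdot₁ h₁ h₁q =>
      hsol.unique_of_tendsto_atTop hV.isWBI.contDiff hT hK h₁ (h₁q.trans hend.symm),
    ⟨θ, hθT, hθ, hθlim, hnear⟩, hasymp⟩
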